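/- Let $X$ be a compact connected Riemann surface of genus $1$, let $\omega$ be a holomorphic differential on $X$ with $\frac{i}{2}\int_X \omega\wedge\bar\omega = 1$, and let $\mu = \frac{i}{2}\,\omega\wedge\bar\omega$ be the fundamental $(1,1)$-form of $X$ (it does not depend on the choice of $\omega$). Let $G : X\times X\to\mathbb{R}_{\ge 0}$ be the Arakelov-Green function of $X$, that is, the unique function such that (i) $G(P,Q)^2$ is $C^\infty$ on $X\times X$, and $G$ vanishes exactly on the diagonal, with multiplicity $1$ (in a local coordinate $z$, $G(P,Q)=|z(P)-z(Q)|\cdot u(P,Q)$ with $u$ positive and $C^\infty$); (ii) for all $P\in X$, $\partial_Q\bar\partial_Q \log G(P,Q)^2 = 2\pi i\,\mu(Q)$ for $Q\neq P$; (iii) for all $P\in X$, $\int_X \log G(P,Q)\,\mu(Q)=0$. Suppose that $y^2 = 4(x-\alpha_1)(x-\alpha_2)(x-\alpha_3)$, with distinct $\alpha_1,\alpha_2,\alpha_3\in\mathbb{C}$, is a Weierstrass equation for $X$: $x,y$ are meromorphic functions on $X$, holomorphic outside a point $O$, with poles of order $2$ and $3$ at $O$, such that $Q\mapsto (x(Q):y(Q):1)$,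 $O\mapsto(0:1:0)$ is an isomorphism of $X$ onto the plane projective curve with this affine equation. (This includes every Weierstrass equation $y^2=4x^3-px-q$, with $\alpha_1,\alpha_2,\alpha_3$ the roots of the right-hand side.) Let $P_i\in X$ be the point with $(x(P_i),y(P_i))=(\alpha_i,0)$, for $i=1,2,3$. Then for all $i,j,k$ with $\{i,j,k\}=\{1,2,3\}$, \[ G(P_i,P_j)^{12} = \frac{16\,|\alpha_i-\alpha_j|^2}{|\alpha_i-\alpha_k|\cdot|\alpha_j-\alpha_k|}. \] -/

import Mathlib

open scoped Manifold ContDiff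
open MeasureTheory

noncomputable section

namespace RiemannSurface

variable (X : Type*) [TopologicalSpace X] [ChartedSpace ℂ X]

/-- Complex covector fields on `X`: an assignment of a `ℂ`-linear form on the (complex) tangent
space at each point. These are the (not necessarily continuous) differentials of type `(1,0)`. -/
abbrev CovectorField : Type _ := (p : X) → (TangentSpace 𝓘(ℂ) p →L[ℂ] ℂ)

variable {X}

/-- The coefficient `h` of a differential `η = h dz` in the local coordinate `z` given by the
chart `e`. It is meaningful on `e.target`. -/
def coeff (η : CovectorField X) (e : OpenPartialHomeomorph X ℂ) (z : ℂ) : ℂ :=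
  η (e.symm z) (mfderiv 𝓘(ℂ) 𝓘(ℂ) e.symm z (1 : ℂ))

variable (X)

/-- The space `H⁰(X, Ω¹)` of holomorphic differentials on `X`: in every chart `η = h dz` with
`h` holomorphic. -/
def holomorphicDifferentials : Submodule ℂ (CovectorField X) where
  carrier := {η | ∀ e ∈ atlas ℂ X, DifferentiableOn ℂ (coeff η e) e.target}
  add_mem' := fun ha hb e he => (ha e he).add (hb e he)
  zero_mem' := fun _ _ => differentiableOn_const (0 : ℂ)
  smul_mem' := fun c _ ha e he => (ha e he).const_smul c

/-- The genus of `X`, as the dimension of the space of holomorphic differentials. -/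
def genus : ℕ := Module.finrank ℂ (holomorphicDifferentials X)

variable {X}

/-- The positive measure on `X` given by the `(1,1)`-form `(i/2) η ∧ η̄`.
In a chart with coordinate `z = s + i t` and `η = h dz` one has
`(i/2) η ∧ η̄ = |h|² (i/2) dz ∧ dz̄ = |h|² ds dt`. For holomorphic `η` these local measures are the
restrictions of one measure to the chart domains, and that measure is their supremum. -/
def areaMeasure [MeasurableSpace X] (η : CovectorField X) : Measure X :=
  ⨆ p : X, Measure.map (chartAt ℂ p).symm
    ((volume.restrict (chartAt ℂ p).target).withDensity
      fun z => ENNReal.ofReal (‖coeff η (chartAt ℂ p) z‖ ^ 2))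

/-- `η` is a holomorphic differential of norm `1` for the hermitian inner product
`(η, ξ) = (i/2) ∫ η ∧ ξ̄`. On a surface of genus `1`, such an `η` is an orthonormal basis
of the space of holomorphic differentials, and `(i/2) η ∧ η̄` is the fundamental `(1,1)`-form. -/
def IsUnitDifferential [MeasurableSpace X] (η : CovectorField X) : Prop :=
  η ∈ holomorphicDifferentials X ∧ areaMeasure η Set.univ = 1

/-- The coefficient `∂²φ/∂z∂z̄ = (φ_ss + φ_tt) / 4` (with `z = s + i t`) of `dz ∧ dz̄` in `∂∂̄φ`. -/
def ddbarCoeff (φ : ℂ → ℝ) (z : ℂ) : ℂ := ((Laplacian.laplacian φ z : ℝ) : ℂ) / 4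

/-- The coefficient of `dz ∧ dz̄` in the `(1,1)`-form `(i/2) η ∧ η̄`, in the chart `e`. -/
def formCoeff (η : CovectorField X) (e : OpenPartialHomeomorph X ℂ) (z : ℂ) : ℂ :=
  Complex.I / 2 * (coeff η e z * (starRingEnd ℂ) (coeff η e z))

/-- `G` is the Arakelov-Green function of the compact connected Riemann surface `X` of genus `1`.
The form `μ = (i/2) η ∧ η̄` in the last field is the fundamental `(1,1)`-form of `X`. -/
structure IsArakelovGreenFunction [MeasurableSpace X] (G : X → X → ℝ) : Prop where
  nonneg : ∀ P Q, 0 ≤ G P Q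
  /-- `G²` is `C^∞` on `X × X` (as a real manifold). -/
  smooth_sq : ContMDiff (𝓘(ℝ, ℂ).prod 𝓘(ℝ, ℂ)) 𝓘(ℝ, ℝ) ∞ fun R : X × X => G R.1 R.2 ^ 2
  /-- `G` vanishes exactly on the diagonal. -/
  eq_zero_iff : ∀ P Q, G P Q = 0 ↔ P = Q
  /-- `G` vanishes with multiplicity one: in a local coordinate `z`, `G(P,Q)` is
  `|z(P) - z(Q)|` times a positive `C^∞` function. -/
  multiplicity_one : ∀ e ∈ atlas ℂ X, ∃ u : X × X → ℝ,
    ContMDiffOn (𝓘(ℝ, ℂ).prod 𝓘(ℝ, ℂ)) 𝓘(ℝ, ℝ) ∞ u (e.source ×ˢ e.source) ∧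
    ∀ P ∈ e.source, ∀ Q ∈ e.source, 0 < u (P, Q) ∧ G P Q = ‖e P - e Q‖ * u (P, Q)
  /-- For every `P`: `∂∂̄ log G(P,·)² = 2πi μ` away from `P`, and `∫ log G(P,·) μ = 0`. -/
  curvature_and_normalization : ∃ η : CovectorField X, IsUnitDifferential η ∧
    (∀ P, ∀ e ∈ atlas ℂ X, ∀ z ∈ e.target, e.symm z ≠ P →
      ddbarCoeff (fun w => Real.log (G P (e.symm w) ^ 2)) z
        = 2 * Real.pi * Complex.I * formCoeff η e z) ∧
    (∀ P, Integrable (fun Q => Real.log (G P Q)) (areaMeasure η) ∧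
      ∫ Q, Real.log (G P Q) ∂(areaMeasure η) = 0)

/-- `y² = 4 (x - α₀) (x - α₁) (x - α₂)`, with distinct `αᵢ`, is a Weierstrass equation for `X`
through the functions `x, y`, with origin `O`: the map `Q ↦ (x(Q) : y(Q) : 1)`, `O ↦ (0 : 1 : 0)`
is an isomorphism of `X` onto the plane projective curve with this (affine) equation. The values
`x O`, `y O` are irrelevant. -/
structure IsWeierstrassEquation (α : Fin 3 → ℂ) (O : X) (x y : X → ℂ) : Prop where
  distinct : Function.Injective α
  holomorphic_x : MDifferentiableOn 𝓘(ℂ) 𝓘(ℂ) x {O}ᶜ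
  holomorphic_y : MDifferentiableOn 𝓘(ℂ) 𝓘(ℂ) y {O}ᶜ
  /-- `x` has a pole of order `2` at `O`. -/
  pole_x : meromorphicOrderAt (x ∘ (chartAt ℂ O).symm) (chartAt ℂ O O) = ((-2 : ℤ) : WithTop ℤ)
  /-- `y` has a pole of order `3` at `O`. -/
  pole_y : meromorphicOrderAt (y ∘ (chartAt ℂ O).symm) (chartAt ℂ O O) = ((-3 : ℤ) : WithTop ℤ)
  bijOn : Set.BijOn (fun Q => (x Q, y Q)) {O}ᶜ
    {w : ℂ × ℂ | w.2 ^ 2 = 4 * (w.1 - α 0) * (w.1 - α 1) * (w.1 - α 2)}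

end RiemannSurface

end

namespace RiemannSurface

open Filter Set Metric
open scoped Topology

/-! ### Local analysis in the plane -/

/-- An injective holomorphic function has nonzero derivative. -/
theorem deriv_ne_zero_of_injOn {f : ℂ → ℂ} {z₀ : ℂ} {s : Set ℂ} (hf : AnalyticAt ℂ f z₀)
    (hs : s ∈ 𝓝 z₀) (hinj : InjOn f s) : deriv f z₀ ≠ 0 := by
  have hnc : ∀ z ∈ interior s, ¬ ∀ᶠ w in 𝓝 z, f w = f z := by
    intro z hz h
    have h1 : ∀ᶠ w in 𝓝[≠] z, f w = f z ∧ w ∈ s ∧ w ≠ z := by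
      filter_upwards [h.filter_mono nhdsWithin_le_nhds,
        (isOpen_interior.mem_nhds hz |> mem_nhdsWithin_of_mem_nhds), self_mem_nhdsWithin]
        with w h1 h2 h3
      exact ⟨h1, interior_subset h2, h3⟩
    obtain ⟨w, h1, h2, h3⟩ := h1.exists
    exact h3 (hinj h2 (interior_subset hz) h1)
  have hz₀ : z₀ ∈ interior s := mem_interior_iff_mem_nhds.2 hs
  have hd : ∀ᶠ z in 𝓝[≠] z₀, deriv f z ≠ 0 := by
    rcases hf.deriv.eventually_eq_zero_or_eventually_ne_zero with h | h
    · exfalso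
      apply hnc z₀ hz₀
      obtain ⟨r, hr, hr'⟩ := Metric.eventually_nhds_iff_ball.1 (h.and hf.eventually_analyticAt)
      filter_upwards [ball_mem_nhds z₀ hr] with w hw
      refine (convex_ball z₀ r).is_const_of_fderivWithin_eq_zero (𝕜 := ℂ)
        (fun z hz => (hr' z hz).2.differentiableAt.differentiableWithinAt) (fun z hz => ?_) hw
        (mem_ball_self hr)
      rw [fderivWithin_of_isOpen isOpen_ball hz]
      ext
      simpa using (hr' z hz).1
    · exact h
  have hd' : ∀ᶠ z in 𝓝 z₀, z ≠ z₀ → deriv f z ≠ 0 := eventually_nhdsWithin_iff.1 hd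
  obtain ⟨r, hr, hr'⟩ := Metric.eventually_nhds_iff_ball.1
    ((hd'.and hf.eventually_analyticAt).and (isOpen_interior.mem_nhds hz₀ : interior s ∈ 𝓝 z₀))
  set B := ball z₀ r
  have hB : B ⊆ s := fun z hz => interior_subset (hr' z hz).2
  set g := Function.invFunOn f B
  have hg : ∀ z ∈ B, g (f z) = z := fun z hz => (hinj.mono hB).leftInvOn_invFunOn hz
  have hop : ∀ z ∈ B, 𝓝 (f z) ≤ map f (𝓝 z) := fun z hz =>
    (hr' z hz).1.2.eventually_constant_or_nhds_le_map_nhds.resolve_left (hnc z (hr' z hz).2)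
  have hgB : ∀ z ∈ B, ∀ᶠ w in 𝓝 (f z), f (g w) = w := by
    intro z hz
    apply hop z hz
    rw [mem_map]
    filter_upwards [isOpen_ball.mem_nhds hz] with w hw
    simp [hg w hw]
  have hgc : ∀ z ∈ B, ContinuousAt g (f z) := by
    intro z hz
    rw [ContinuousAt, hg z hz]
    refine Tendsto.mono_left ?_ (hop z hz)
    rw [tendsto_map'_iff]
    refine tendsto_id.congr' ?_
    filter_upwards [isOpen_ball.mem_nhds hz] with w hw
    simp [hg w hw]
  have hz₀B : z₀ ∈ B := mem_ball_self hr
  have hgd : AnalyticAt ℂ g (f z₀) := by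
    apply Complex.analyticAt_of_differentiable_on_punctured_nhds_of_continuousAt _ (hgc z₀ hz₀B)
    rw [eventually_nhdsWithin_iff]
    apply hop z₀ hz₀B
    rw [mem_map]
    filter_upwards [isOpen_ball.mem_nhds hz₀B] with w hw hne
    have hne' : w ≠ z₀ := by rintro rfl; exact hne rfl
    have hfd : HasDerivAt f (deriv f w) (g (f w)) := by
      rw [hg w hw]; exact (hr' w hw).1.2.differentiableAt.hasDerivAt
    exact (HasDerivAt.of_local_left_inverse (hgc w hw) hfd ((hr' w hw).1.1 hne')
      (hgB w hw)).differentiableAt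
  have hcomp : HasDerivAt (g ∘ f) (deriv g (f z₀) * deriv f z₀) z₀ :=
    hgd.differentiableAt.hasDerivAt.comp z₀ hf.differentiableAt.hasDerivAt
  have hid : HasDerivAt (g ∘ f) 1 z₀ := by
    refine (hasDerivAt_id z₀).congr_of_eventuallyEq ?_
    filter_upwards [isOpen_ball.mem_nhds hz₀B] with w hw
    simp [hg w hw]
  intro h
  have := hcomp.unique hid
  simp [h] at this

theorem eventually_eq_add_of_hasDerivAt_one {s : ℂ → ℂ} {z₀ : ℂ}
    (h : ∀ᶠ z in 𝓝 z₀, HasDerivAt s 1 z) : ∀ᶠ z in 𝓝 z₀, s z = s z₀ + (z - z₀) := by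
  obtain ⟨r, hr, hr'⟩ := Metric.eventually_nhds_iff_ball.1 h
  filter_upwards [ball_mem_nhds z₀ hr] with w hw
  have hd : ∀ z ∈ ball z₀ r, HasDerivAt (fun z => s z - z) 0 z := fun z hz => by
    have := (hr' z hz).sub (hasDerivAt_id z)
    rw [sub_self] at this
    exact this
  have := (convex_ball z₀ r).is_const_of_fderivWithin_eq_zero (𝕜 := ℂ) (f := fun z => s z - z)
        (fun z hz => (hd z hz).differentiableAt.differentiableWithinAt) (fun z hz => by
          rw [fderivWithin_of_isOpen isOpen_ball hz]
          ext
          simp [(hd z hz).deriv]) hw (mem_ball_self hr)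
  linear_combination this

theorem laplacian_eq_fderiv_fderiv (f : ℂ → ℝ) (z : ℂ) :
    Laplacian.laplacian f z = fderiv ℝ (fderiv ℝ f) z 1 1
      + fderiv ℝ (fderiv ℝ f) z Complex.I Complex.I := by
  rw [InnerProductSpace.laplacian_eq_iteratedFDeriv_complexPlane]
  simp [iteratedFDeriv_two_apply]

/-- The Laplacian of a composition with a holomorphic map. -/
theorem laplacian_comp_analyticAt {f : ℂ → ℝ} {k : ℂ → ℂ} {z : ℂ} (hk : AnalyticAt ℂ k z)
    (hf : ContDiffAt ℝ 2 f (k z)) :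
    Laplacian.laplacian (f ∘ k) z = ‖deriv k z‖ ^ 2 * Laplacian.laplacian f (k z) := by
  set m : ℂ →L[ℝ] ℂ →L[ℝ] ℂ := ContinuousLinearMap.mul ℝ ℂ
  have h1 : ∀ᶠ w in 𝓝 z, fderiv ℝ (f ∘ k) w = (fderiv ℝ f (k w)).comp (m (deriv k w)) := by
    have hf' : ∀ᶠ w in 𝓝 z, ContDiffAt ℝ 2 f (k w) :=
      hk.continuousAt.eventually (hf.eventually (by simp))
    filter_upwards [hf', hk.eventually_analyticAt] with w hw1 hw2
    have hkw : HasFDerivAt k (m (deriv k w)) w := by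
      have := hw2.differentiableAt.hasDerivAt.hasFDerivAt.restrictScalars ℝ
      refine this.congr_fderiv ?_
      ext <;> simp [m, mul_comm]
    exact ((hw1.differentiableAt (by simp)).hasFDerivAt.comp w hkw).fderiv
  have hD : HasFDerivAt (fderiv ℝ f) (fderiv ℝ (fderiv ℝ f) (k z)) (k z) :=
    ((hf.fderiv_right (m := 1) (by norm_num)).differentiableAt (by simp)).hasFDerivAt
  have hk1 : HasFDerivAt k (m (deriv k z)) z := by
    have := hk.differentiableAt.hasDerivAt.hasFDerivAt.restrictScalars ℝ
    refine this.congr_fderiv ?_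
    ext <;> simp [m, mul_comm]
  have hk2 : HasFDerivAt (deriv k) (m (deriv (deriv k) z)) z := by
    have := hk.deriv.differentiableAt.hasDerivAt.hasFDerivAt.restrictScalars ℝ
    refine this.congr_fderiv ?_
    ext <;> simp [m, mul_comm]
  have h2 : ∀ v : ℂ, fderiv ℝ (fderiv ℝ (f ∘ k)) z v v =
      fderiv ℝ (fderiv ℝ f) (k z) (deriv k z * v) (deriv k z * v)
        + fderiv ℝ f (k z) (deriv (deriv k) z * v * v) := by
    intro v
    rw [EventuallyEq.fderiv_eq h1]
    have h3 := (hD.comp z hk1).clm_comp (m.hasFDerivAt.comp z hk2)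
    have h4 : fderiv ℝ (fun w => (fderiv ℝ f (k w)).comp (m (deriv k w))) z = _ := h3.fderiv
    rw [h4]
    simp [m]
    ring
  rw [laplacian_eq_fderiv_fderiv, laplacian_eq_fderiv_fderiv, h2, h2]
  have hsym : IsSymmSndFDerivAt ℝ f (k z) := hf.isSymmSndFDerivAt (by simp)
  set B := fderiv ℝ (fderiv ℝ f) (k z)
  set a := deriv k z
  have e1 : a * 1 = a.re • (1 : ℂ) + a.im • Complex.I := by
    apply Complex.ext <;> simp
  have e2 : a * Complex.I = (-a.im) • (1 : ℂ) + a.re • Complex.I := by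
    apply Complex.ext <;> simp
  have e3 : deriv (deriv k) z * Complex.I * Complex.I = - (deriv (deriv k) z * 1 * 1) := by
    rw [mul_assoc, Complex.I_mul_I]; ring
  have e4 : B Complex.I 1 = B 1 Complex.I := hsym _ _
  rw [e1, e2, e3, ← Complex.normSq_eq_norm_sq, Complex.normSq_apply]
  simp only [map_add, map_smul, add_apply, smul_apply,
    smul_eq_mul, map_neg, e4]
  ring

/-- A function which near each point agrees, off that point, with a continuous function, has a
continuous modification. -/
theorem exists_extension {X Y : Type*} [TopologicalSpace X] [T1Space X]
    [∀ x : X, NeBot (𝓝[≠] x)] [TopologicalSpace Y] [T2Space Y] [Nonempty Y] (r : X → Y) :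
    ∃ f : X → Y, ∀ (Q : X) (ψ : X → Y), (∀ᶠ Q' in 𝓝 Q, ContinuousAt ψ Q') →
      r =ᶠ[𝓝[≠] Q] ψ → f =ᶠ[𝓝 Q] ψ := by
  refine ⟨fun Q => limUnder (𝓝[≠] Q) r, fun Q ψ hc hr => ?_⟩
  have h1 : ∀ᶠ Q' in 𝓝 Q, r =ᶠ[𝓝[≠] Q'] ψ := by
    have h2 := (eventually_nhdsWithin_iff.1 hr).eventually_nhds
    filter_upwards [h2] with Q' h3
    by_cases hQ : Q' = Q
    · subst hQ; exact hr
    · have h4 : ∀ᶠ x in 𝓝 Q', x ≠ Q := isOpen_ne.mem_nhds hQ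
      exact ((h3.and h4).mono fun x hx => hx.1 hx.2).filter_mono nhdsWithin_le_nhds
  filter_upwards [hc, h1] with Q' h2 h3
  have : Tendsto r (𝓝[≠] Q') (𝓝 (ψ Q')) :=
    (h2.tendsto.mono_left nhdsWithin_le_nhds).congr' h3.symm
  exact this.limUnder_eq

/-! ### Functions with logarithmic singularities -/

/-- Near `z₀`, `v = n log |z - z₀| + u` with `u` of class `C²`, and `Δ v = κ` off `z₀`. -/
def LogSing (v : ℂ → ℝ) (z₀ : ℂ) (n κ : ℝ) : Prop :=
  ∃ u : ℂ → ℝ, ContDiffAt ℝ 2 u z₀ ∧ (∀ᶠ z in 𝓝[≠] z₀, v z = n * Real.log ‖z - z₀‖ + u z) ∧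
    ∀ᶠ z in 𝓝[≠] z₀, Laplacian.laplacian u z = κ

theorem eventually_punctured_contDiffAt {u : ℂ → ℝ} {z₀ : ℂ} (hu : ContDiffAt ℝ 2 u z₀) :
    ∀ᶠ z in 𝓝[≠] z₀, ContDiffAt ℝ 2 u z :=
  (hu.eventually (by simp)).filter_mono nhdsWithin_le_nhds

theorem LogSing.add {v w : ℂ → ℝ} {z₀ : ℂ} {n m κ μ : ℝ} (hv : LogSing v z₀ n κ)
    (hw : LogSing w z₀ m μ) : LogSing (fun z => v z + w z) z₀ (n + m) (κ + μ) := by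
  obtain ⟨u, hu, h1, h2⟩ := hv
  obtain ⟨u', hu', h1', h2'⟩ := hw
  refine ⟨u + u', hu.add hu', ?_, ?_⟩
  · filter_upwards [h1, h1'] with z h h'
    simp only [h, h', Pi.add_apply]; ring
  · filter_upwards [h2, h2', (eventually_punctured_contDiffAt hu), (eventually_punctured_contDiffAt hu')] with z h h' c c'
    rw [c.laplacian_add c', h, h']

theorem LogSing.const_mul {v : ℂ → ℝ} {z₀ : ℂ} {n κ : ℝ} (hv : LogSing v z₀ n κ) (c : ℝ) :
    LogSing (fun z => c * v z) z₀ (c * n) (c * κ) := by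
  obtain ⟨u, hu, h1, h2⟩ := hv
  refine ⟨c • u, hu.const_smul c, ?_, ?_⟩
  · filter_upwards [h1] with z h
    simp only [h, Pi.smul_apply, smul_eq_mul]; ring
  · filter_upwards [h2, (eventually_punctured_contDiffAt hu)] with z h c'
    rw [InnerProductSpace.laplacian_smul _ c', h, smul_eq_mul]

theorem LogSing.neg {v : ℂ → ℝ} {z₀ : ℂ} {n κ : ℝ} (hv : LogSing v z₀ n κ) :
    LogSing (fun z => - v z) z₀ (-n) (-κ) := by
  simpa using hv.const_mul (-1)

theorem LogSing.sub {v w : ℂ → ℝ} {z₀ : ℂ} {n m κ μ : ℝ} (hv : LogSing v z₀ n κ)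
    (hw : LogSing w z₀ m μ) : LogSing (fun z => v z - w z) z₀ (n - m) (κ - μ) := by
  simpa [sub_eq_add_neg] using hv.add hw.neg

theorem LogSing.sum {ι : Type*} (s : Finset ι) {v : ι → ℂ → ℝ} {z₀ : ℂ} {n κ : ι → ℝ}
    (hv : ∀ i ∈ s, LogSing (v i) z₀ (n i) (κ i)) :
    LogSing (fun z => ∑ i ∈ s, v i z) z₀ (∑ i ∈ s, n i) (∑ i ∈ s, κ i) := by
  classical
  induction s using Finset.induction_on with
  | empty =>
    refine ⟨0, contDiffAt_const, by simp, ?_⟩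
    refine Eventually.of_forall fun z => ?_
    have := InnerProductSpace.laplacian_const (E := ℂ) (c := (0 : ℝ))
    exact congrFun this z
  | insert a s ha ih =>
    simp only [Finset.sum_insert ha]
    exact (hv a (by simp)).add (ih fun i hi => hv i (by simp [hi]))

/-- Substitution of an affine function. -/
theorem LogSing.comp_affine {v : ℂ → ℝ} {a b z₀ : ℂ} {n κ : ℝ} (ha : a ≠ 0)
    (hv : LogSing v (a * z₀ + b) n κ) :
    LogSing (fun z => v (a * z + b)) z₀ n (‖a‖ ^ 2 * κ) := by
  obtain ⟨u, hu, h1, h2⟩ := hv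
  set k : ℂ → ℂ := fun z => a * z + b
  have hk : ∀ z, AnalyticAt ℂ k z := fun z => by fun_prop
  have hkd : ∀ z, deriv k z = a := fun z => by simp [k]
  have hkt : Tendsto k (𝓝[≠] z₀) (𝓝[≠] (k z₀)) := by
    refine tendsto_nhdsWithin_of_tendsto_nhds_of_eventually_within _
      ((hk z₀).continuousAt.tendsto.mono_left nhdsWithin_le_nhds) ?_
    filter_upwards [self_mem_nhdsWithin] with z hz
    simp only [mem_compl_iff, mem_singleton_iff, k, add_left_inj] at hz ⊢
    exact fun h => hz (mul_left_cancel₀ ha h)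
  have huk : ContDiffAt ℝ 2 (u ∘ k) z₀ := by
    refine ContDiffAt.comp z₀ hu ?_
    exact (hk z₀).contDiffAt.restrict_scalars ℝ
  refine ⟨fun z => n * Real.log ‖a‖ + (u ∘ k) z, contDiffAt_const.add huk, ?_, ?_⟩
  · filter_upwards [hkt.eventually h1, self_mem_nhdsWithin] with z h hz
    have : k z - (a * z₀ + b) = a * (z - z₀) := by simp only [k]; ring
    have hz' : z - z₀ ≠ 0 := sub_ne_zero.2 hz
    rw [this, norm_mul, Real.log_mul (norm_ne_zero_iff.2 ha) (norm_ne_zero_iff.2 hz')] at h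
    simp only [Function.comp_apply]
    rw [show v (a * z + b) = v (k z) from rfl, h]; ring
  · filter_upwards [hkt.eventually h2, hkt.eventually (eventually_punctured_contDiffAt hu),
      (eventually_punctured_contDiffAt huk)] with z h h' h''
    have := (contDiffAt_const (c := n * Real.log ‖a‖)).laplacian_add h''
    have e : (fun z => n * Real.log ‖a‖ + (u ∘ k) z)
        = (fun _ : ℂ => n * Real.log ‖a‖) + (u ∘ k) := rfl
    rw [e, this, laplacian_comp_analyticAt (hk z) h', h, hkd]
    simp

/-- The logarithm of the norm of a meromorphic function. -/
theorem LogSing.log_norm {f : ℂ → ℂ} {z₀ : ℂ} {n : ℤ} (hf : MeromorphicAt f z₀)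
    (hn : meromorphicOrderAt f z₀ = n) : LogSing (fun z => Real.log ‖f z‖) z₀ n 0 := by
  obtain ⟨g, hg, hg0, h⟩ := (meromorphicOrderAt_eq_int_iff hf).1 hn
  have hh := hg.harmonicAt_log_norm hg0
  refine ⟨_, hh.1, ?_, hh.2.filter_mono nhdsWithin_le_nhds⟩
  have hg1 : ∀ᶠ z in 𝓝[≠] z₀, g z ≠ 0 :=
    (hg.continuousAt.eventually_ne hg0).filter_mono nhdsWithin_le_nhds
  filter_upwards [h, self_mem_nhdsWithin, hg1] with z h hz hg1
  have hz' : ‖z - z₀‖ ≠ 0 := norm_ne_zero_iff.2 (sub_ne_zero.2 hz)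
  rw [h, norm_smul, norm_zpow, Real.log_mul (zpow_ne_zero _ hz') (norm_ne_zero_iff.2 hg1),
    Real.log_zpow]

/-- A function on the plane, harmonic up to removable singularities and periodic with respect to
a cocompact group, is constant. -/
theorem eventually_eq_const_of_logSing {v : ℂ → ℝ} (hv : ∀ z, LogSing v z 0 0) {R : ℝ}
    (hR : ∀ z, ∃ w, ‖w‖ ≤ R ∧ ∀ t, v (z + t) = v (w + t)) :
    ∃ C, ∀ z₀, ∀ᶠ z in 𝓝[≠] z₀, v z = C := by
  choose u hu h1 h2 using hv
  obtain ⟨f, hf⟩ := exists_extension (X := ℂ) v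
  have hfu : ∀ z, f =ᶠ[𝓝 z] u z := fun z => by
    refine hf z (u z) ?_ ?_
    · filter_upwards [(hu z).eventually (by simp)] with w hw using hw.continuousAt
    · filter_upwards [h1 z] with w hw
      simp [hw]
  have hvf : ∀ z, f =ᶠ[𝓝[≠] z] v := fun z => by
    filter_upwards [(hfu z).filter_mono nhdsWithin_le_nhds, h1 z] with w hw hw'
    simp [hw, hw']
  have hfc : ∀ z, ContDiffAt ℝ 2 f z := fun z => (hu z).congr_of_eventuallyEq (hfu z)
  have hcont : Continuous f := continuous_iff_continuousAt.2 fun z => (hfc z).continuousAt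
  have hlap : ∀ z, Laplacian.laplacian f z = 0 := by
    intro z
    have hc : ContinuousAt (Laplacian.laplacian f) z := by
      have e : Laplacian.laplacian f = fun z => fderiv ℝ (fderiv ℝ f) z 1 1
        + fderiv ℝ (fderiv ℝ f) z Complex.I Complex.I := funext (laplacian_eq_fderiv_fderiv f)
      have hD : ContinuousAt (fderiv ℝ (fderiv ℝ f)) z :=
        (((hfc z).fderiv_right (m := 1) (by norm_num)).fderiv_right (m := 0)
          (by norm_num)).continuousAt
      rw [e]
      fun_prop
    have h0 : ∀ᶠ w in 𝓝[≠] z, Laplacian.laplacian f w = 0 := by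
      filter_upwards [h2 z, (hfu z).eventually_nhds.filter_mono nhdsWithin_le_nhds] with w hw hw'
      rw [InnerProductSpace.laplacian_congr_nhds hw' |>.eq_of_nhds, hw]
    refine tendsto_nhds_unique (hc.tendsto.mono_left nhdsWithin_le_nhds)
      (tendsto_const_nhds.congr' ?_) (f := Laplacian.laplacian f) (l := 𝓝[≠] z)
    filter_upwards [h0] with w hw using hw.symm
  have htr : ∀ z, Tendsto (fun t => v (z + t)) (𝓝[≠] 0) (𝓝 (f z)) := by
    intro z
    have h3 : Tendsto v (𝓝[≠] z) (𝓝 (f z)) :=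
      (hcont.continuousAt.tendsto.mono_left nhdsWithin_le_nhds).congr' (hvf z)
    refine h3.comp (tendsto_nhdsWithin_of_tendsto_nhds_of_eventually_within _ ?_ ?_)
    · have : Continuous fun t : ℂ => z + t := by fun_prop
      simpa using (this.tendsto 0).mono_left nhdsWithin_le_nhds
    · filter_upwards [self_mem_nhdsWithin] with t ht
      simpa using ht
  have hper : ∀ z, ∃ w, ‖w‖ ≤ R ∧ f z = f w := by
    intro z
    obtain ⟨w, hw, h⟩ := hR z
    refine ⟨w, hw, tendsto_nhds_unique (htr z) ?_⟩
    simpa only [h] using htr w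
  have hbd : Bornology.IsBounded (range f) := by
    refine ((isCompact_closedBall (0 : ℂ) R).image hcont).isBounded.subset ?_
    rintro _ ⟨z, rfl⟩
    obtain ⟨w, hw, h⟩ := hper z
    exact ⟨w, by simpa using hw, h.symm⟩
  have hconst := InnerProductSpace.bounded_harmonic_on_complex_plane_is_constant f
    (fun z _ => ⟨hfc z, Eventually.of_forall fun w => hlap w⟩) hbd
  refine ⟨f 0, fun z => ?_⟩
  filter_upwards [hvf z] with w hw
  rw [← hw, hconst w 0]

end RiemannSurface

namespace RiemannSurface

open Filter Set Metric
open scoped Topology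

variable {X : Type*} [TopologicalSpace X] [ChartedSpace ℂ X]

/-! ### Changes of charts -/

theorem mdifferentiableAt_iff_chart [IsManifold 𝓘(ℂ) ω X] {f : X → ℂ}
    {e : OpenPartialHomeomorph X ℂ} (he : e ∈ atlas ℂ X) {z : ℂ} (hz : z ∈ e.target) :
    MDifferentiableAt 𝓘(ℂ) 𝓘(ℂ) f (e.symm z) ↔ DifferentiableAt ℂ (f ∘ e.symm) z := by
  constructor
  · intro h
    exact (h.comp z (mdifferentiableAt_atlas_symm he hz)).differentiableAt
  · intro h
    have h1 : MDifferentiableAt 𝓘(ℂ) 𝓘(ℂ) e (e.symm z) :=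
      mdifferentiableAt_atlas he (e.map_target hz)
    have h2 : MDifferentiableAt 𝓘(ℂ) 𝓘(ℂ) (f ∘ e.symm) (e (e.symm z)) := by
      rw [e.right_inv hz]; exact h.mdifferentiableAt
    refine (h2.comp _ h1).congr_of_eventuallyEq ?_
    filter_upwards [e.open_source.mem_nhds (e.map_target hz)] with w hw
    simp [e.left_inv hw]

theorem differentiableAt_transition [IsManifold 𝓘(ℂ) ω X] {e e' : OpenPartialHomeomorph X ℂ}
    (he : e ∈ atlas ℂ X) (he' : e' ∈ atlas ℂ X) {z : ℂ} (hz : z ∈ e.target)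
    (hz' : e.symm z ∈ e'.source) : DifferentiableAt ℂ (e' ∘ e.symm) z :=
  (mdifferentiableAt_iff_chart he hz).1 (mdifferentiableAt_atlas he' hz')

theorem deriv_comp_transition [IsManifold 𝓘(ℂ) ω X] {e e' : OpenPartialHomeomorph X ℂ}
    (he : e ∈ atlas ℂ X) (he' : e' ∈ atlas ℂ X) {z : ℂ} (hz : z ∈ e.target)
    (hz' : e.symm z ∈ e'.source) {f : X → ℂ} (hf : MDifferentiableAt 𝓘(ℂ) 𝓘(ℂ) f (e.symm z)) :
    deriv (f ∘ e.symm) z = deriv (f ∘ e'.symm) (e' (e.symm z)) * deriv (e' ∘ e.symm) z := by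
  have h1 : DifferentiableAt ℂ (f ∘ e'.symm) ((e' ∘ e.symm) z) := by
    refine (mdifferentiableAt_iff_chart he' (e'.map_source hz')).1 ?_
    simpa [e'.left_inv hz'] using hf
  have h2 := differentiableAt_transition he he' hz hz'
  refine (EventuallyEq.deriv_eq ?_).trans (deriv_comp z h1 h2)
  have : ∀ᶠ w in 𝓝 z, e.symm w ∈ e'.source :=
    (e.continuousAt_symm hz).eventually (e'.open_source.mem_nhds hz')
  filter_upwards [this] with w hw
  simp [e'.left_inv hw]

theorem deriv_transition_ne_zero [IsManifold 𝓘(ℂ) ω X] {e e' : OpenPartialHomeomorph X ℂ}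
    (he : e ∈ atlas ℂ X) (he' : e' ∈ atlas ℂ X) {z : ℂ} (hz : z ∈ e.target)
    (hz' : e.symm z ∈ e'.source) : deriv (e' ∘ e.symm) z ≠ 0 := by
  have h := deriv_comp_transition he he' hz hz' (mdifferentiableAt_atlas he (e.map_target hz))
  have h1 : deriv (e ∘ e.symm) z = 1 := by
    rw [EventuallyEq.deriv_eq (f := id)]
    · simp
    · filter_upwards [e.open_target.mem_nhds hz] with w hw
      simp [e.right_inv hw]
  intro h0
  rw [h1, h0, mul_zero] at h
  exact one_ne_zero h

theorem coeff_transition [IsManifold 𝓘(ℂ) ω X] (η : CovectorField X)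
    {e e' : OpenPartialHomeomorph X ℂ}
    (he : e ∈ atlas ℂ X) (he' : e' ∈ atlas ℂ X) {z : ℂ} (hz : z ∈ e.target)
    (hz' : e.symm z ∈ e'.source) :
    coeff η e z = coeff η e' (e' (e.symm z)) * deriv (e' ∘ e.symm) z := by
  have h1 : MDifferentiableAt 𝓘(ℂ) 𝓘(ℂ) e'.symm ((e' ∘ e.symm) z) :=
    mdifferentiableAt_atlas_symm he' (e'.map_source hz')
  have h2 := differentiableAt_transition he he' hz hz'
  have h3 : mfderiv 𝓘(ℂ) 𝓘(ℂ) e.symm z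
      = (mfderiv 𝓘(ℂ) 𝓘(ℂ) e'.symm ((e' ∘ e.symm) z)).comp
        (mfderiv 𝓘(ℂ) 𝓘(ℂ) (e' ∘ e.symm) z) := by
    rw [← mfderiv_comp z h1 h2.mdifferentiableAt]
    refine EventuallyEq.mfderiv_eq ?_
    have : ∀ᶠ w in 𝓝 z, e.symm w ∈ e'.source :=
      (e.continuousAt_symm hz).eventually (e'.open_source.mem_nhds hz')
    filter_upwards [this] with w hw
    simp [e'.left_inv hw]
  have h4 : mfderiv 𝓘(ℂ) 𝓘(ℂ) (e' ∘ e.symm) z (1 : ℂ) = deriv (e' ∘ e.symm) z • (1 : ℂ) := by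
    rw [mfderiv_eq_fderiv, smul_eq_mul, mul_one]
    rfl
  have key : ∀ P : X, P = e.symm z → η (e.symm z) (mfderiv 𝓘(ℂ) 𝓘(ℂ) e.symm z (1 : ℂ))
      = η P (mfderiv 𝓘(ℂ) 𝓘(ℂ) e.symm z (1 : ℂ)) := by
    rintro P rfl; rfl
  unfold coeff
  rw [key _ (e'.left_inv hz'), h3]
  change η _ (mfderiv 𝓘(ℂ) 𝓘(ℂ) e'.symm ((e' ∘ e.symm) z)
    (mfderiv 𝓘(ℂ) 𝓘(ℂ) (e' ∘ e.symm) z (1 : ℂ))) = _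
  rw [h4]
  have hL : ∀ (L : ℂ →L[ℂ] ℂ) (d : ℂ), L (d • 1) = L 1 * d := fun L d => by
    rw [map_smul, smul_eq_mul, mul_comm]
  exact hL ((η (e'.symm ((e' ∘ e.symm) z))).comp
    (mfderiv 𝓘(ℂ) 𝓘(ℂ) e'.symm ((e' ∘ e.symm) z))) _

theorem nhdsNE_neBot (Q : X) : NeBot (𝓝[≠] Q) := by
  by_contra h
  rw [not_neBot, ← isOpen_singleton_iff_punctured_nhds] at h
  set e := chartAt ℂ Q
  have h1 := e.isOpen_image_of_subset_source h (by simp [e])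
  rw [image_singleton] at h1
  exact not_isOpen_singleton _ h1

omit [ChartedSpace ℂ X] in
theorem tendsto_chart_nhdsNE {e : OpenPartialHomeomorph X ℂ} {Q : X} (hQ : Q ∈ e.source) :
    Tendsto e (𝓝[≠] Q) (𝓝[≠] (e Q)) := by
  refine tendsto_nhdsWithin_of_tendsto_nhds_of_eventually_within _
    ((e.continuousAt hQ).tendsto.mono_left nhdsWithin_le_nhds) ?_
  filter_upwards [self_mem_nhdsWithin,
    (e.open_source.mem_nhds hQ |> mem_nhdsWithin_of_mem_nhds)] with w h1 h2 h3
  exact h1 (e.injOn h2 hQ h3)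

/-! ### The differential `dx / y` -/

section Weierstrass

variable {α : Fin 3 → ℂ} {O : X} {x y : X → ℂ}

theorem IsWeierstrassEquation.eq [T2Space X] (hW : IsWeierstrassEquation α O x y) {Q : X}
    (hQ : Q ≠ O) :
    y Q ^ 2 = 4 * (x Q - α 0) * (x Q - α 1) * (x Q - α 2) := hW.bijOn.mapsTo hQ

theorem IsWeierstrassEquation.mdiff_x [T2Space X] (hW : IsWeierstrassEquation α O x y) {Q : X}
    (hQ : Q ≠ O) : MDifferentiableAt 𝓘(ℂ) 𝓘(ℂ) x Q :=
  (hW.holomorphic_x Q hQ).mdifferentiableAt (isOpen_ne.mem_nhds hQ)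

theorem IsWeierstrassEquation.mdiff_y [T2Space X] (hW : IsWeierstrassEquation α O x y) {Q : X}
    (hQ : Q ≠ O) : MDifferentiableAt 𝓘(ℂ) 𝓘(ℂ) y Q :=
  (hW.holomorphic_y Q hQ).mdifferentiableAt (isOpen_ne.mem_nhds hQ)

/-- The derivative of the right hand side of the Weierstrass equation. -/
def cubicDeriv (α : Fin 3 → ℂ) (t : ℂ) : ℂ :=
  4 * ((t - α 1) * (t - α 2) + (t - α 0) * (t - α 2) + (t - α 0) * (t - α 1))

theorem hasDerivAt_cubic (α : Fin 3 → ℂ) (t : ℂ) :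
    HasDerivAt (fun t => 4 * (t - α 0) * (t - α 1) * (t - α 2)) (cubicDeriv α t) t := by
  have h := fun i => (hasDerivAt_id' t).sub_const (α i)
  refine ((((h 0).const_mul 4).mul (h 1)).mul (h 2)).congr_deriv ?_
  simp only [cubicDeriv, Pi.mul_apply]; ring

theorem cubicDeriv_ne_zero (hα : Function.Injective α) {t : ℂ}
    (ht : 4 * (t - α 0) * (t - α 1) * (t - α 2) = 0) : cubicDeriv α t ≠ 0 := by
  have h01 : α 0 - α 1 ≠ 0 := sub_ne_zero.2 (hα.ne (by decide))
  have h02 : α 0 - α 2 ≠ 0 := sub_ne_zero.2 (hα.ne (by decide))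
  have h12 : α 1 - α 2 ≠ 0 := sub_ne_zero.2 (hα.ne (by decide))
  have h10 : α 1 - α 0 ≠ 0 := sub_ne_zero.2 (hα.ne (by decide))
  have h20 : α 2 - α 0 ≠ 0 := sub_ne_zero.2 (hα.ne (by decide))
  have h21 : α 2 - α 1 ≠ 0 := sub_ne_zero.2 (hα.ne (by decide))
  simp only [mul_eq_zero, OfNat.ofNat_ne_zero, false_or, sub_eq_zero] at ht
  rcases ht with (rfl | rfl) | rfl <;> simp [cubicDeriv, *]

theorem IsWeierstrassEquation.order_eq [T2Space X] [IsManifold 𝓘(ℂ) ω X]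
    (hW : IsWeierstrassEquation α O x y) (Q : X) :
    MeromorphicAt (x ∘ (chartAt ℂ Q).symm) (chartAt ℂ Q Q) ∧
    MeromorphicAt (y ∘ (chartAt ℂ Q).symm) (chartAt ℂ Q Q) ∧
    ∃ m : ℤ, meromorphicOrderAt (deriv (x ∘ (chartAt ℂ Q).symm)) (chartAt ℂ Q Q) = m ∧
      meromorphicOrderAt (y ∘ (chartAt ℂ Q).symm) (chartAt ℂ Q Q) = m := by
  by_cases hQ : Q = O
  · subst hQ
    refine ⟨meromorphicAt_of_meromorphicOrderAt_ne_zero ?_,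
      meromorphicAt_of_meromorphicOrderAt_ne_zero ?_, -3, ?_, hW.pole_y⟩
    · rw [hW.pole_x]; decide
    · rw [hW.pole_y]; decide
    · refine meromorphicOrderAt_deriv (n := -3) (by norm_num) ?_
      rw [hW.pole_x]; rfl
  set e := chartAt ℂ Q with he
  have hea : e ∈ atlas ℂ X := chart_mem_atlas ℂ Q
  have hQe : Q ∈ e.source := mem_chart_source ℂ Q
  set z₀ := e Q with hz₀
  have hz₀t : z₀ ∈ e.target := e.map_source hQe
  have hsz₀ : e.symm z₀ = Q := e.left_inv hQe
  have hev : ∀ᶠ z in 𝓝 z₀, z ∈ e.target ∧ e.symm z ≠ O :=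
    Eventually.and (e.open_target.mem_nhds hz₀t)
      ((e.continuousAt_symm hz₀t).eventually (isOpen_ne.mem_nhds (by rwa [hsz₀])))
  have hx : AnalyticAt ℂ (x ∘ e.symm) z₀ := by
    rw [Complex.analyticAt_iff_eventually_differentiableAt]
    filter_upwards [hev] with z hz
    exact (mdifferentiableAt_iff_chart hea hz.1).1 (hW.mdiff_x hz.2)
  have hy : AnalyticAt ℂ (y ∘ e.symm) z₀ := by
    rw [Complex.analyticAt_iff_eventually_differentiableAt]
    filter_upwards [hev] with z hz
    exact (mdifferentiableAt_iff_chart hea hz.1).1 (hW.mdiff_y hz.2)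
  refine ⟨hx.meromorphicAt, hy.meromorphicAt, ?_⟩
  have hxQ : (x ∘ e.symm) z₀ = x Q := by simp [hsz₀]
  have hyQ : (y ∘ e.symm) z₀ = y Q := by simp [hsz₀]
  have hinj : ∀ z w : ℂ, (z ∈ e.target ∧ e.symm z ≠ O) → (w ∈ e.target ∧ e.symm w ≠ O) →
      x (e.symm z) = x (e.symm w) → y (e.symm z) = y (e.symm w) → z = w := by
    intro z w hz hw h1 h2
    refine e.symm.injOn hz.1 hw.1 (hW.bijOn.injOn hz.2 hw.2 (Prod.ext h1 h2))
  by_cases hy0 : y Q = 0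
  · have hcub := hW.eq hQ
    rw [hy0, zero_pow two_ne_zero] at hcub
    have hcd := cubicDeriv_ne_zero hW.distinct hcub.symm
    have hstr : HasStrictDerivAt (fun t => 4 * (t - α 0) * (t - α 1) * (t - α 2))
        (cubicDeriv α (x Q)) (x Q) := by
      refine ContDiffAt.hasStrictDerivAt' (n := 1) ?_ (hasDerivAt_cubic α _) (by simp)
      fun_prop
    obtain ⟨s, hs, hsinj⟩ : ∃ s ∈ 𝓝 (x Q),
        InjOn (fun t => 4 * (t - α 0) * (t - α 1) * (t - α 2)) s := by
      refine ⟨(HasStrictFDerivAt.toOpenPartialHomeomorph _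
        (hstr.hasStrictFDerivAt_equiv hcd)).source, ?_, ?_⟩
      · exact (HasStrictFDerivAt.toOpenPartialHomeomorph _
          (hstr.hasStrictFDerivAt_equiv hcd)).open_source.mem_nhds
          (HasStrictFDerivAt.mem_toOpenPartialHomeomorph_source
            (hstr.hasStrictFDerivAt_equiv hcd))
      · exact (HasStrictFDerivAt.toOpenPartialHomeomorph _
          (hstr.hasStrictFDerivAt_equiv hcd)).injOn
    have hxs : ∀ᶠ z in 𝓝 z₀, (x ∘ e.symm) z ∈ s :=
      hx.continuousAt.eventually (by rw [hxQ]; exact hs)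
    have hyd : deriv (y ∘ e.symm) z₀ ≠ 0 := by
      refine deriv_ne_zero_of_injOn hy (hev.and hxs) ?_
      intro z hz w hw h
      refine hinj z w hz.1 hw.1 (hsinj hz.2 hw.2 ?_) h
      simp only [Function.comp_apply] at h ⊢
      rw [← hW.eq hz.1.2, ← hW.eq hw.1.2, h]
    have hyo : meromorphicOrderAt (y ∘ e.symm) z₀ = 1 := by
      rw [hy.meromorphicOrderAt_eq,
        hy.analyticOrderAt_eq_one_of_zero_deriv_ne_zero (by rw [hyQ, hy0]) hyd]
      rfl
    have hydo : meromorphicOrderAt (deriv (y ∘ e.symm)) z₀ = 0 := by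
      rw [hy.deriv.meromorphicOrderAt_eq, hy.deriv.analyticOrderAt_eq_zero.2 hyd]
      rfl
    have hpa : AnalyticAt ℂ (fun z => cubicDeriv α ((x ∘ e.symm) z)) z₀ := by
      have : Differentiable ℂ (cubicDeriv α) := by
        unfold cubicDeriv
        fun_prop
      exact (this.analyticAt _).comp hx
    have hpo : meromorphicOrderAt (fun z => cubicDeriv α ((x ∘ e.symm) z)) z₀ = 0 := by
      rw [hpa.meromorphicOrderAt_eq, hpa.analyticOrderAt_eq_zero.2 (by rwa [hxQ])]
      rfl
    have hrel : ∀ᶠ z in 𝓝 z₀, 2 * (y ∘ e.symm) z * deriv (y ∘ e.symm) z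
        = cubicDeriv α ((x ∘ e.symm) z) * deriv (x ∘ e.symm) z := by
      filter_upwards [hev.eventually_nhds, hx.eventually_analyticAt, hy.eventually_analyticAt]
        with z hz hxz hyz
      have h1 : HasDerivAt (fun w => (y ∘ e.symm) w ^ 2) _ z :=
        hyz.differentiableAt.hasDerivAt.pow 2
      have h2 := (hasDerivAt_cubic α ((x ∘ e.symm) z)).comp z hxz.differentiableAt.hasDerivAt
      have h3 := h2.congr_of_eventuallyEq (f₁ := fun w => (y ∘ e.symm) w ^ 2) (by
        filter_upwards [hz] with w hw
        exact hW.eq hw.2)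
      have := h1.unique h3
      simpa using this
    refine ⟨1, ?_, hyo⟩
    have h1 : meromorphicOrderAt ((y ∘ e.symm) * deriv (y ∘ e.symm)) z₀ = 1 := by
      rw [meromorphicOrderAt_mul hy.meromorphicAt hy.deriv.meromorphicAt, hyo, hydo, add_zero]
    have h2 : meromorphicOrderAt ((fun z => 2⁻¹ * cubicDeriv α ((x ∘ e.symm) z)) *
        deriv (x ∘ e.symm)) z₀ = 1 := by
      rw [← h1]
      refine meromorphicOrderAt_congr (EventuallyEq.filter_mono ?_ nhdsWithin_le_nhds)
      filter_upwards [hrel] with z hz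
      simp only [Pi.mul_apply]
      linear_combination -(1 / 2) * hz
    rw [meromorphicOrderAt_mul_of_ne_zero (g := fun z => 2⁻¹ * cubicDeriv α ((x ∘ e.symm) z))
      (analyticAt_const.mul hpa)] at h2
    · exact h2
    · simpa [hsz₀] using hcd
  · refine ⟨0, ?_, ?_⟩
    · have hyne : ∀ᶠ z in 𝓝 z₀, ‖(y ∘ e.symm) z - y Q‖ < ‖y Q‖ := by
        have : Tendsto (fun z => ‖(y ∘ e.symm) z - y Q‖) (𝓝 z₀) (𝓝 0) := by
          have := (hy.continuousAt.tendsto.sub_const (y Q)).norm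
          rwa [hyQ, sub_self, norm_zero] at this
        exact this.eventually (gt_mem_nhds (norm_pos_iff.2 hy0))
      have hxd : deriv (x ∘ e.symm) z₀ ≠ 0 := by
        refine deriv_ne_zero_of_injOn hx (hev.and hyne) ?_
        intro z hz w hw h
        refine hinj z w hz.1 hw.1 h ?_
        simp only [Function.comp_apply] at h
        have h2 := hW.eq hz.1.2
        rw [h, ← hW.eq hw.1.2, sq_eq_sq_iff_eq_or_eq_neg] at h2
        refine h2.resolve_right fun h3 => ?_
        have h4 := hz.2
        have h5 := hw.2
        simp only [Function.comp_apply] at h4 h5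
        have h6 : (2 : ℂ) * y Q = -(y (e.symm z) - y Q) - (y (e.symm w) - y Q) := by
          rw [h3]; ring
        have h7 : 2 * ‖y Q‖ ≤ ‖y (e.symm z) - y Q‖ + ‖y (e.symm w) - y Q‖ := by
          calc 2 * ‖y Q‖ = ‖(2 : ℂ) * y Q‖ := by simp
            _ ≤ _ := by
              rw [h6]
              refine (norm_sub_le _ _).trans ?_
              rw [norm_neg]
        linarith
      rw [hx.deriv.meromorphicOrderAt_eq, hx.deriv.analyticOrderAt_eq_zero.2 hxd]
      rfl
    · rw [hy.meromorphicOrderAt_eq, hy.analyticOrderAt_eq_zero.2 (by rwa [hyQ])]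
      rfl

end Weierstrass

end RiemannSurface

namespace RiemannSurface

open Filter Set Metric
open scoped Topology

variable {X : Type*} [TopologicalSpace X] [ChartedSpace ℂ X]

section Weierstrass

variable {α : Fin 3 → ℂ} {O : X} {x y : X → ℂ}

theorem analyticAt_coeff {η : CovectorField X} (hη : η ∈ holomorphicDifferentials X)
    {e : OpenPartialHomeomorph X ℂ} (he : e ∈ atlas ℂ X) {z : ℂ} (hz : z ∈ e.target) :
    AnalyticAt ℂ (coeff η e) z :=
  (hη e he).analyticAt (e.open_target.mem_nhds hz)

theorem exists_coeff_ne_zero [MeasurableSpace X] {η : CovectorField X}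
    (hη : IsUnitDifferential η) :
    ∃ (p : X) (z : ℂ), z ∈ (chartAt ℂ p).target ∧ coeff η (chartAt ℂ p) z ≠ 0 := by
  by_contra! h
  have h0 : areaMeasure η = 0 := by
    unfold areaMeasure
    refine le_antisymm (iSup_le fun p => ?_) (Measure.zero_le _)
    have : (volume.restrict (chartAt ℂ p).target).withDensity
      (fun z => ENNReal.ofReal (‖coeff η (chartAt ℂ p) z‖ ^ 2)) = 0 := by
      rw [withDensity_congr_ae (g := 0), withDensity_zero]
      filter_upwards [ae_restrict_mem (chartAt ℂ p).open_target.measurableSet] with z hz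
      simp [h p z hz]
    rw [this, Measure.map_zero]
  have := hη.2
  rw [h0] at this
  simp at this

/-- The differentials `η` and `dx / y` are proportional, and `η` has no zeros. -/
theorem IsWeierstrassEquation.exists_mul_deriv_eq [T2Space X] [CompactSpace X] [ConnectedSpace X]
    [IsManifold 𝓘(ℂ) ω X] [MeasurableSpace X]
    (hW : IsWeierstrassEquation α O x y) {η : CovectorField X} (hη : IsUnitDifferential η) :
    ∃ c : ℂ, c ≠ 0 ∧ ∀ e ∈ atlas ℂ X, ∀ z ∈ e.target, coeff η e z ≠ 0 ∧
      (e.symm z ≠ O → c * deriv (x ∘ e.symm) z = y (e.symm z) * coeff η e z) := by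
  have : ∀ Q : X, NeBot (𝓝[≠] Q) := nhdsNE_neBot
  set r : X → ℂ := fun Q => y Q * coeff η (chartAt ℂ Q) (chartAt ℂ Q Q) /
    deriv (x ∘ (chartAt ℂ Q).symm) (chartAt ℂ Q Q) with hr
  obtain ⟨f, hf⟩ := exists_extension r
  have hS : ∀ Q : X, ∀ᶠ Q' in 𝓝[≠] Q, Q' ≠ O := by
    intro Q
    by_cases hQ : Q = O
    · subst hQ; exact self_mem_nhdsWithin
    · exact mem_nhdsWithin_of_mem_nhds (isOpen_ne.mem_nhds hQ)
  have hch : ∀ Q : X, ∀ᶠ Q' in 𝓝[≠] Q, Q' ≠ O ∧ Q' ∈ (chartAt ℂ Q).source ∧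
      r Q' = y Q' * coeff η (chartAt ℂ Q) (chartAt ℂ Q Q') /
        deriv (x ∘ (chartAt ℂ Q).symm) (chartAt ℂ Q Q') := by
    intro Q
    filter_upwards [hS Q, mem_nhdsWithin_of_mem_nhds
      ((chartAt ℂ Q).open_source.mem_nhds (mem_chart_source ℂ Q))] with Q' h1 h2
    refine ⟨h1, h2, ?_⟩
    have ht := (chartAt ℂ Q).map_source h2
    have hs : (chartAt ℂ Q).symm (chartAt ℂ Q Q') = Q' := (chartAt ℂ Q).left_inv h2
    have hm : (chartAt ℂ Q).symm (chartAt ℂ Q Q') ∈ (chartAt ℂ Q').source := by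
      rw [hs]; exact mem_chart_source ℂ Q'
    have t1 := coeff_transition η (chart_mem_atlas ℂ Q) (chart_mem_atlas ℂ Q') ht hm
    have t2 := deriv_comp_transition (chart_mem_atlas ℂ Q) (chart_mem_atlas ℂ Q') ht hm
      (f := x) (by rw [hs]; exact hW.mdiff_x h1)
    have t3 := deriv_transition_ne_zero (chart_mem_atlas ℂ Q) (chart_mem_atlas ℂ Q') ht hm
    rw [hs] at t1 t2
    rw [t1, t2, ← mul_assoc, mul_div_mul_right _ _ t3]
  have hψ : ∀ Q : X, ∃ ψ : ℂ → ℂ, AnalyticAt ℂ ψ (chartAt ℂ Q Q) ∧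
      f =ᶠ[𝓝 Q] ψ ∘ chartAt ℂ Q ∧ ∀ᶠ z in 𝓝[≠] (chartAt ℂ Q Q),
        ψ z * deriv (x ∘ (chartAt ℂ Q).symm) z
          = y ((chartAt ℂ Q).symm z) * coeff η (chartAt ℂ Q) z := by
    intro Q
    obtain ⟨hx, hy, m, hm1, hm2⟩ := hW.order_eq Q
    have hQs := mem_chart_source ℂ Q
    have hh := analyticAt_coeff hη.1 (chart_mem_atlas ℂ Q) ((chartAt ℂ Q).map_source hQs)
    set e := chartAt ℂ Q
    set ρ : ℂ → ℂ := coeff η e * ((y ∘ e.symm) / deriv (x ∘ e.symm)) with hρ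
    have hρm : MeromorphicAt ρ (e Q) := hh.meromorphicAt.mul (hy.div hx.deriv)
    have hρo : 0 ≤ meromorphicOrderAt ρ (e Q) := by
      rw [meromorphicOrderAt_mul hh.meromorphicAt (hy.div hx.deriv),
        meromorphicOrderAt_div hy hx.deriv, hm1, hm2]
      have : ((m : WithTop ℤ) - (m : WithTop ℤ)) = 0 := by norm_cast; simp
      rw [this, add_zero]
      exact hh.meromorphicOrderAt_nonneg
    have hψo : 0 ≤ meromorphicOrderAt (toMeromorphicNFAt ρ (e Q)) (e Q) := by
      rwa [meromorphicOrderAt_congr hρm.eq_nhdsNE_toMeromorphicNFAt.symm]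
    have hψa := (meromorphicNFAt_toMeromorphicNFAt).meromorphicOrderAt_nonneg_iff_analyticAt.1 hψo
    have heq := hρm.eq_nhdsNE_toMeromorphicNFAt
    set ψ := toMeromorphicNFAt ρ (e Q)
    refine ⟨ψ, hψa, hf Q _ ?_ ?_, ?_⟩
    · filter_upwards [(e.continuousAt hQs).eventually hψa.eventually_analyticAt,
        e.open_source.mem_nhds hQs] with Q' h1 h2
      exact h1.continuousAt.comp (e.continuousAt h2)
    · filter_upwards [hch Q, (tendsto_chart_nhdsNE hQs).eventually heq] with Q' h1 h2
      rw [h1.2.2, Function.comp_apply, ← h2]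
      simp only [hρ, Pi.mul_apply, Pi.div_apply, Function.comp_apply, e.left_inv h1.2.1]
      change y Q' * coeff η e (e Q') / deriv (x ∘ e.symm) (e Q') = _
      ring
    · have hne : ∀ᶠ z in 𝓝[≠] (e Q), deriv (x ∘ e.symm) z ≠ 0 := by
        rw [← meromorphicOrderAt_ne_top_iff_eventually_ne_zero hx.deriv, hm1]
        exact WithTop.coe_ne_top
      filter_upwards [heq, hne] with z h1 h2
      rw [← h1]
      simp only [hρ, Pi.mul_apply, Pi.div_apply, Function.comp_apply]
      field_simp
  have hfd : MDifferentiable 𝓘(ℂ) 𝓘(ℂ) f := by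
    intro Q
    obtain ⟨ψ, hψa, hfe, -⟩ := hψ Q
    refine MDifferentiableAt.congr_of_eventuallyEq ?_ hfe
    exact hψa.differentiableAt.mdifferentiableAt.comp Q
      (mdifferentiableAt_atlas (chart_mem_atlas ℂ Q) (mem_chart_source ℂ Q))
  obtain ⟨c, hc⟩ := hfd.exists_eq_const_of_compactSpace
  have hmain : ∀ Q : X, ∀ᶠ z in 𝓝[≠] (chartAt ℂ Q Q),
      c * deriv (x ∘ (chartAt ℂ Q).symm) z
          = y ((chartAt ℂ Q).symm z) * coeff η (chartAt ℂ Q) z := by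
    intro Q
    obtain ⟨ψ, hψa, hfe, hrel⟩ := hψ Q
    have hQs := mem_chart_source ℂ Q
    have h1 : ∀ᶠ z in 𝓝 (chartAt ℂ Q Q), ψ z = c := by
      have ht := (chartAt ℂ Q).map_source hQs
      have hcs := (chartAt ℂ Q).continuousAt_symm ht
      rw [ContinuousAt, (chartAt ℂ Q).left_inv hQs] at hcs
      filter_upwards [hcs.eventually hfe, (chartAt ℂ Q).open_target.mem_nhds ht] with z h2 h3
      rw [hc] at h2
      simpa [(chartAt ℂ Q).right_inv h3] using h2.symm
    filter_upwards [hrel, h1.filter_mono nhdsWithin_le_nhds] with z h2 h3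
    rw [← h2, h3]
  have hyne : ∀ Q : X, ∀ᶠ z in 𝓝[≠] (chartAt ℂ Q Q), y ((chartAt ℂ Q).symm z) ≠ 0 := by
    intro Q
    obtain ⟨hx, hy, m, hm1, hm2⟩ := hW.order_eq Q
    exact (meromorphicOrderAt_ne_top_iff_eventually_ne_zero hy).1 (by rw [hm2]; exact WithTop.coe_ne_top)
  have hc0 : c ≠ 0 := by
    rintro rfl
    obtain ⟨p, z, hz, hpz⟩ := exists_coeff_ne_zero hη
    set Q := (chartAt ℂ p).symm z
    have ht := coeff_transition η (chart_mem_atlas ℂ p) (chart_mem_atlas ℂ Q) hz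
      (mem_chart_source ℂ Q)
    have h0 : ∀ᶠ w in 𝓝[≠] (chartAt ℂ Q Q), coeff η (chartAt ℂ Q) w = 0 := by
      filter_upwards [hmain Q, hyne Q] with w h1 h2
      rw [zero_mul, eq_comm, mul_eq_zero] at h1
      exact h1.resolve_left h2
    have hh := analyticAt_coeff hη.1 (chart_mem_atlas ℂ Q)
      ((chartAt ℂ Q).map_source (mem_chart_source ℂ Q))
    have h1 : coeff η (chartAt ℂ Q) (chartAt ℂ Q Q) = 0 :=
      tendsto_nhds_unique (hh.continuousAt.tendsto.mono_left nhdsWithin_le_nhds)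
        (tendsto_const_nhds.congr' (h0.mono fun w hw => hw.symm))
    rw [h1, zero_mul] at ht
    exact hpz ht
  have hh0 : ∀ Q : X, coeff η (chartAt ℂ Q) (chartAt ℂ Q Q) ≠ 0 := by
    intro Q
    obtain ⟨hx, hy, m, hm1, hm2⟩ := hW.order_eq Q
    have hh := analyticAt_coeff hη.1 (chart_mem_atlas ℂ Q)
      ((chartAt ℂ Q).map_source (mem_chart_source ℂ Q))
    have h1 : meromorphicOrderAt ((fun _ => c) * deriv (x ∘ (chartAt ℂ Q).symm))
        (chartAt ℂ Q Q) = m := by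
      rw [meromorphicOrderAt_mul_of_ne_zero analyticAt_const hc0, hm1]
    have h2 : meromorphicOrderAt ((y ∘ (chartAt ℂ Q).symm) * coeff η (chartAt ℂ Q))
        (chartAt ℂ Q Q) = m := by
      rw [← h1]
      exact meromorphicOrderAt_congr ((hmain Q).mono fun z hz => hz.symm)
    rw [meromorphicOrderAt_mul hy hh.meromorphicAt, hm2] at h2
    have h3 : meromorphicOrderAt (coeff η (chartAt ℂ Q)) (chartAt ℂ Q Q) = 0 := by
      revert h2
      generalize meromorphicOrderAt (coeff η (chartAt ℂ Q)) (chartAt ℂ Q Q) = k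
      intro h2
      induction k using WithTop.recTopCoe with
      | top => simp at h2
      | coe k => norm_cast at h2 ⊢; omega
    obtain ⟨d, hd, hdt⟩ := tendsto_ne_zero_of_meromorphicOrderAt_eq_zero hh.meromorphicAt h3
    rwa [tendsto_nhds_unique (hh.continuousAt.tendsto.mono_left nhdsWithin_le_nhds) hdt]
  refine ⟨c, hc0, fun e he z hz => ?_⟩
  set Q := e.symm z with hQ
  have hQs := mem_chart_source ℂ Q
  have ht := coeff_transition η he (chart_mem_atlas ℂ Q) hz hQs
  have hτ := deriv_transition_ne_zero he (chart_mem_atlas ℂ Q) hz hQs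
  refine ⟨by rw [ht]; exact mul_ne_zero (hh0 Q) hτ, fun hQO => ?_⟩
  have ht2 := deriv_comp_transition he (chart_mem_atlas ℂ Q) hz hQs (hW.mdiff_x hQO)
  have hQt := (chartAt ℂ Q).map_source hQs
  have hsQ := (chartAt ℂ Q).left_inv hQs
  have hev : ∀ᶠ z in 𝓝 (chartAt ℂ Q Q), z ∈ (chartAt ℂ Q).target ∧ (chartAt ℂ Q).symm z ≠ O :=
    Eventually.and ((chartAt ℂ Q).open_target.mem_nhds hQt)
      (((chartAt ℂ Q).continuousAt_symm hQt).eventually (isOpen_ne.mem_nhds (by rwa [hsQ])))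
  have hx : AnalyticAt ℂ (x ∘ (chartAt ℂ Q).symm) (chartAt ℂ Q Q) := by
    rw [Complex.analyticAt_iff_eventually_differentiableAt]
    filter_upwards [hev] with z hz
    exact (mdifferentiableAt_iff_chart (chart_mem_atlas ℂ Q) hz.1).1 (hW.mdiff_x hz.2)
  have hy : ContinuousAt (y ∘ (chartAt ℂ Q).symm) (chartAt ℂ Q Q) :=
    ((mdifferentiableAt_iff_chart (chart_mem_atlas ℂ Q) hQt).1
      (hW.mdiff_y (by rwa [hsQ]))).continuousAt
  have hh := (analyticAt_coeff hη.1 (chart_mem_atlas ℂ Q) hQt).continuousAt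
  have hval : c * deriv (x ∘ (chartAt ℂ Q).symm) (chartAt ℂ Q Q) = y Q *
      coeff η (chartAt ℂ Q) (chartAt ℂ Q Q) := by
    have l1 : Tendsto (fun z => c * deriv (x ∘ (chartAt ℂ Q).symm) z) (𝓝[≠] (chartAt ℂ Q Q))
        (𝓝 (c * deriv (x ∘ (chartAt ℂ Q).symm) (chartAt ℂ Q Q))) :=
      (hx.deriv.continuousAt.tendsto.mono_left nhdsWithin_le_nhds).const_mul c
    have l2 : Tendsto (fun z => y ((chartAt ℂ Q).symm z) * coeff η (chartAt ℂ Q) z)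
        (𝓝[≠] (chartAt ℂ Q Q)) (𝓝 (y ((chartAt ℂ Q).symm (chartAt ℂ Q Q)) *
          coeff η (chartAt ℂ Q) (chartAt ℂ Q Q))) :=
      (hy.mul hh).tendsto.mono_left nhdsWithin_le_nhds
    rw [hsQ] at l2
    exact tendsto_nhds_unique (l1.congr' (hmain Q)) l2
  rw [ht, ht2, ← mul_assoc, ← mul_assoc, ← hval]

end Weierstrass

end RiemannSurface

namespace RiemannSurface

open Filter Set Metric
open scoped Topology

/-! ### Surfaces with a translation structure -/

section Translation

variable {X : Type*} [TopologicalSpace X] {𝒯 : Set (OpenPartialHomeomorph X ℂ)}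

/-- `σ` is, locally at the points of `U`, a translation in the charts of `𝒯`. -/
def IsFlowLine (𝒯 : Set (OpenPartialHomeomorph X ℂ)) (σ : ℂ → X) (U : Set ℂ) : Prop :=
  ∀ z ∈ U, ∀ c ∈ 𝒯, σ z ∈ c.source → ∀ᶠ t in 𝓝 (0 : ℂ), σ (z + t) = c.symm (c (σ z) + t)

theorem tendsto_add_nhds_zero (z : ℂ) : Tendsto (fun w => w - z) (𝓝 z) (𝓝 0) := by
  have : Continuous fun w : ℂ => w - z := by fun_prop
  simpa using this.tendsto z

theorem eventually_add_iff {p : ℂ → Prop} (z : ℂ) :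
    (∀ᶠ t in 𝓝 (0 : ℂ), p (z + t)) ↔ ∀ᶠ w in 𝓝 z, p w := by
  constructor
  · intro h
    filter_upwards [(tendsto_add_nhds_zero z).eventually h] with w hw
    simpa using hw
  · intro h
    have : Tendsto (fun t : ℂ => z + t) (𝓝 0) (𝓝 z) := by
      have : Continuous fun t : ℂ => z + t := by fun_prop
      simpa using this.tendsto 0
    exact this.eventually h

theorem IsFlowLine.continuousAt (cov : ∀ Q : X, ∃ c ∈ 𝒯, Q ∈ c.source) {σ : ℂ → X} {U : Set ℂ}
    (hσ : IsFlowLine 𝒯 σ U) {z : ℂ} (hz : z ∈ U) : ContinuousAt σ z := by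
  obtain ⟨c, hc, hcz⟩ := cov (σ z)
  have h := hσ z hz c hc hcz
  have h1 : ∀ᶠ w in 𝓝 z, c.symm (c (σ z) + (w - z)) = σ w := by
    filter_upwards [(tendsto_add_nhds_zero z).eventually h] with w hw
    rw [← hw]; congr 1; ring
  have h2 : ContinuousAt (fun w => c.symm (c (σ z) + (w - z))) z := by
    refine ContinuousAt.comp (g := c.symm) (f := fun w => c (σ z) + (w - z)) ?_ (by fun_prop)
    simp only [sub_self, add_zero]
    exact c.continuousAt_symm (c.map_source hcz)
  exact h2.congr h1

theorem IsFlowLine.eqOn [T2Space X] (cov : ∀ Q : X, ∃ c ∈ 𝒯, Q ∈ c.source) {σ τ : ℂ → X}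
    {U : Set ℂ} (hU : IsPreconnected U) (hσ : IsFlowLine 𝒯 σ U) (hτ : IsFlowLine 𝒯 τ U)
    {z₀ : ℂ} (hz₀ : z₀ ∈ U) (h : σ z₀ = τ z₀) : EqOn σ τ U := by
  set E : Set ℂ := {z | ∀ᶠ w in 𝓝 z, σ w = τ w}
  have hE : IsOpen E := isOpen_iff_mem_nhds.2 fun z hz => Eventually.eventually_nhds hz
  have key : ∀ z ∈ U, σ z = τ z → z ∈ E := by
    intro z hz he
    obtain ⟨c, hc, hcz⟩ := cov (σ z)
    refine (eventually_add_iff z).1 ?_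
    filter_upwards [hσ z hz c hc hcz, hτ z hz c hc (he ▸ hcz)] with t h1 h2
    rw [h1, h2, he]
  have := hU.subset_of_closure_inter_subset hE ⟨z₀, hz₀, key z₀ hz₀ h⟩ (by
    rintro z ⟨hzE, hzU⟩
    refine key z hzU ?_
    have hfreq : ∃ᶠ w in 𝓝 z, σ w = τ w :=
      (mem_closure_iff_frequently.1 hzE).mono fun w hw =>
        Eventually.self_of_nhds (p := fun w => σ w = τ w) hw
    by_contra hne
    obtain ⟨w, hw1, hw2⟩ := (hfreq.and_eventually
      (((hσ.continuousAt cov hzU).prodMk (hτ.continuousAt cov hzU)).eventually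
        (isClosed_diagonal.isOpen_compl.mem_nhds (x := (σ z, τ z)) hne))).exists
    exact hw2 hw1)
  exact fun z hz => Eventually.self_of_nhds (p := fun w => σ w = τ w) (this hz)

theorem IsFlowLine.shift {σ : ℂ → X} {U : Set ℂ} (hσ : IsFlowLine 𝒯 σ U) (w : ℂ) :
    IsFlowLine 𝒯 (fun z => σ (w + z)) {z | w + z ∈ U} := by
  intro z hz c hc hcz
  filter_upwards [hσ (w + z) hz c hc hcz] with t ht
  rw [← ht, add_assoc]

theorem exists_isFlowLine_ball [CompactSpace X] (cov : ∀ Q : X, ∃ c ∈ 𝒯, Q ∈ c.source)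
    (tr : ∀ c ∈ 𝒯, ∀ c' ∈ 𝒯, ∀ Q ∈ c.source, Q ∈ c'.source →
      ∀ᶠ t in 𝓝 (0 : ℂ), c.symm (c Q + t) = c'.symm (c' Q + t)) :
    ∃ r > 0, ∀ Q : X, ∃ σ : ℂ → X, σ 0 = Q ∧ IsFlowLine 𝒯 σ (ball 0 r) := by
  suffices h : ∃ r > 0, ∀ Q ∈ (univ : Set X), ∃ σ : ℂ → X, σ 0 = Q ∧
      IsFlowLine 𝒯 σ (ball 0 r) by simpa using h
  refine isCompact_univ.induction_on (p := fun s => ∃ r > 0, ∀ Q ∈ s, ∃ σ : ℂ → X, σ 0 = Q ∧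
      IsFlowLine 𝒯 σ (ball 0 r)) ⟨1, one_pos, by simp⟩ ?_ ?_ ?_
  · rintro s t hst ⟨r, hr, h⟩
    exact ⟨r, hr, fun Q hQ => h Q (hst hQ)⟩
  · rintro s t ⟨r, hr, h⟩ ⟨r', hr', h'⟩
    refine ⟨min r r', lt_min hr hr', ?_⟩
    rintro Q (hQ | hQ)
    · obtain ⟨σ, h0, h1⟩ := h Q hQ
      exact ⟨σ, h0, fun z hz => h1 z (ball_subset_ball (min_le_left _ _) hz)⟩
    · obtain ⟨σ, h0, h1⟩ := h' Q hQ
      exact ⟨σ, h0, fun z hz => h1 z (ball_subset_ball (min_le_right _ _) hz)⟩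
  · intro Q _
    obtain ⟨c, hc, hcQ⟩ := cov Q
    obtain ⟨ρ, hρ, hρ'⟩ := Metric.isOpen_iff.1 c.open_target (c Q) (c.map_source hcQ)
    refine ⟨c.source ∩ c ⁻¹' ball (c Q) (ρ / 2), mem_nhdsWithin_of_mem_nhds ?_, ρ / 2,
      half_pos hρ, ?_⟩
    · exact (c.isOpen_inter_preimage isOpen_ball).mem_nhds ⟨hcQ, mem_ball_self (half_pos hρ)⟩
    rintro Q' ⟨hQ's, hQ'b⟩
    refine ⟨fun t => c.symm (c Q' + t), by simp [c.left_inv hQ's], ?_⟩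
    intro z hz c' hc' hcz
    have hzt : c Q' + z ∈ c.target := by
      apply hρ'
      rw [mem_preimage, mem_ball, dist_eq_norm] at hQ'b
      rw [mem_ball, dist_eq_norm] at hz ⊢
      have : c Q' + z - c Q = (c Q' - c Q) + (z - 0) := by ring
      rw [this]
      exact (norm_add_le _ _).trans_lt (by linarith)
    filter_upwards [tr c hc c' hc' (c.symm (c Q' + z)) (c.map_target hzt) hcz] with t ht
    rw [← ht, c.right_inv hzt, add_assoc]

/-- On a compact connected surface with a translation structure, the translation flow is defined
for all complex times, and its orbit map is surjective. -/
theorem exists_orbit_map [T2Space X] [CompactSpace X] [ConnectedSpace X]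
    (cov : ∀ Q : X, ∃ c ∈ 𝒯, Q ∈ c.source)
    (tr : ∀ c ∈ 𝒯, ∀ c' ∈ 𝒯, ∀ Q ∈ c.source, Q ∈ c'.source →
      ∀ᶠ t in 𝓝 (0 : ℂ), c.symm (c Q + t) = c'.symm (c' Q + t)) (O : X) :
    ∃ π : ℂ → X, Function.Surjective π ∧ π 0 = O ∧
      (∀ z w t, π z = π w → π (z + t) = π (w + t)) ∧ IsFlowLine 𝒯 π univ := by
  obtain ⟨r, hr, hσ⟩ := exists_isFlowLine_ball cov tr
  choose φ hφ0 hφ using hσ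
  set F : ℂ → X → X := fun z Q => φ Q z with hF
  have hadd : ∀ z w, ‖z‖ < r → ‖w‖ < r → ‖z + w‖ < r → F (z + w) = F z ∘ F w := by
    intro z w hz hw hzw
    funext Q
    set U : Set ℂ := ball 0 r ∩ {z | w + z ∈ ball (0 : ℂ) r}
    have hU : IsPreconnected U := by
      refine ((convex_ball 0 r).inter ?_).isPreconnected
      exact (convex_ball (0 : ℂ) r).translate_preimage_right w
    have h1 : IsFlowLine 𝒯 (fun z => φ Q (w + z)) U := fun z hz => (hφ Q).shift w z hz.2
    have h2 : IsFlowLine 𝒯 (φ (φ Q w)) U := fun z hz => hφ (φ Q w) z hz.1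
    have h3 := h1.eqOn cov hU h2 (z₀ := 0) ⟨mem_ball_self hr, by simpa using hw⟩
      (by simp [hφ0]) (x := z) ⟨by simpa using hz, by simpa [add_comm] using hzw⟩
    simp only [hF, Function.comp_apply]
    rw [← h3, add_comm]
  have hzero : F 0 = id := funext hφ0
  have hpow : ∀ (k : ℕ) (z : ℂ), ‖(k : ℂ) * z‖ < r → F (k * z) = (F z)^[k] := by
    intro k
    induction k with
    | zero => intro z _; simpa using hzero
    | succ k ih =>
      intro z hz
      have hz' : (k + 1 : ℝ) * ‖z‖ < r := by
        have : ‖((k + 1 : ℕ) : ℂ) * z‖ = (k + 1 : ℝ) * ‖z‖ := by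
          rw [norm_mul, Complex.norm_natCast]; push_cast; ring
        rwa [this] at hz
      have hk : (0 : ℝ) ≤ k := k.cast_nonneg
      have h1 : ‖(k : ℂ) * z‖ < r := by
        rw [norm_mul, Complex.norm_natCast]
        nlinarith [norm_nonneg z]
      have h2 : ‖z‖ < r := by nlinarith [norm_nonneg z]
      have e : ((k + 1 : ℕ) : ℂ) * z = k * z + z := by push_cast; ring
      rw [e] at hz ⊢
      rw [hadd _ _ h1 h2 hz, ih z h1, Function.iterate_succ]
  have hindep : ∀ (z : ℂ) (n m : ℕ), n ≠ 0 → m ≠ 0 → ‖z‖ < n * r → ‖z‖ < m * r →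
      (F (z / n))^[n] = (F (z / m))^[m] := by
    have half : ∀ (z : ℂ) (n m : ℕ), n ≠ 0 → m ≠ 0 → ‖z‖ < n * r →
        (F (z / n))^[n] = (F (z / (n * m)))^[n * m] := by
      intro z n m hn hm h
      have hnC : (n : ℂ) ≠ 0 := Nat.cast_ne_zero.2 hn
      have hmC : (m : ℂ) ≠ 0 := Nat.cast_ne_zero.2 hm
      have hnR : (0 : ℝ) < n := Nat.cast_pos.2 (Nat.pos_of_ne_zero hn)
      have e : z / n = m * (z / (n * m)) := by field_simp
      rw [mul_comm n m, Function.iterate_mul, ← hpow m _, ← e]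
      rw [← e, norm_div, Complex.norm_natCast, div_lt_iff₀ hnR]
      linarith
    intro z n m hn hm h1 h2
    rw [half z n m hn hm h1, half z m n hm hn h2, mul_comm n m, mul_comm (n : ℂ)]
  set N : ℂ → ℕ := fun z => ⌊‖z‖ / r⌋₊ + 1
  have hN : ∀ z, ‖z‖ < N z * r := fun z => by
    rw [← div_lt_iff₀ hr]
    simpa [N] using Nat.lt_floor_add_one (‖z‖ / r)
  set Φ : ℂ → X → X := fun z => (F (z / N z))^[N z] with hΦ
  have hΦn : ∀ (z : ℂ) (n : ℕ), n ≠ 0 → ‖z‖ < n * r → Φ z = (F (z / n))^[n] := fun z n hn h =>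
    hindep z (N z) n (Nat.succ_ne_zero _) hn (hN z) h
  have hΦs : ∀ z, ‖z‖ < r → Φ z = F z := fun z h => by
    simpa using hΦn z 1 one_ne_zero (by simpa using h)
  have hΦadd : ∀ z w, Φ (z + w) = Φ z ∘ Φ w := by
    intro z w
    obtain ⟨n, hn⟩ := exists_nat_gt ((‖z‖ + ‖w‖) / r)
    rw [div_lt_iff₀ hr] at hn
    have hn0 : n ≠ 0 := by
      rintro rfl
      have := add_nonneg (norm_nonneg z) (norm_nonneg w)
      simp only [CharP.cast_eq_zero, zero_mul] at hn
      linarith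
    have hnR : (0 : ℝ) < n := Nat.cast_pos.2 (Nat.pos_of_ne_zero hn0)
    have hz : ‖z‖ < n * r := by linarith [norm_nonneg w]
    have hw : ‖w‖ < n * r := by linarith [norm_nonneg z]
    have hzw : ‖z + w‖ < n * r := (norm_add_le _ _).trans_lt hn
    have sm : ∀ v : ℂ, ‖v‖ < n * r → ‖v / n‖ < r := fun v hv => by
      rw [norm_div, Complex.norm_natCast, div_lt_iff₀ hnR]; linarith
    have c1 : F ((z + w) / n) = F (z / n) ∘ F (w / n) := by
      rw [add_div]
      exact hadd _ _ (sm z hz) (sm w hw) (by rw [← add_div]; exact sm _ hzw)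
    have c2 : F ((z + w) / n) = F (w / n) ∘ F (z / n) := by
      rw [add_comm z w, add_div]
      exact hadd _ _ (sm w hw) (sm z hz) (by rw [← add_div, add_comm w z]; exact sm _ hzw)
    have hcomm : Function.Commute (F (z / n)) (F (w / n)) := fun Q =>
      (congrFun c1 Q).symm.trans (congrFun c2 Q)
    rw [hΦn _ n hn0 hz, hΦn _ n hn0 hw, hΦn _ n hn0 hzw, c1, hcomm.comp_iterate]
  have hπadd : ∀ z t, Φ (z + t) O = Φ t (Φ z O) := fun z t => by
    rw [add_comm, hΦadd]; rfl
  have hΦ0 : Φ 0 = id := by rw [hΦs 0 (by simpa using hr), hzero]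
  have hflow : ∀ (Q : X), ∀ c ∈ 𝒯, Q ∈ c.source →
      ∀ᶠ t in 𝓝 (0 : ℂ), Φ t Q = c.symm (c Q + t) := by
    intro Q c hc hQ
    filter_upwards [hφ Q 0 (mem_ball_self hr) c hc (by rwa [hφ0]), ball_mem_nhds 0 hr] with t h1 h2
    rw [hΦs t (by simpa using h2)]
    simpa [hF, hφ0] using h1
  have hnhds : ∀ Q : X, range (fun t => Φ t Q) ∈ 𝓝 Q := by
    intro Q
    obtain ⟨c, hc, hQ⟩ := cov Q
    have h1 := (tendsto_add_nhds_zero (c Q)).eventually (hflow Q c hc hQ)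
    filter_upwards [(c.continuousAt hQ).eventually h1, c.open_source.mem_nhds hQ] with Q' h2 h3
    refine ⟨c Q' - c Q, ?_⟩
    simp only [h2]
    rw [add_sub_cancel, c.left_inv h3]
  refine ⟨fun z => Φ z O, ?_, by simp [hΦ0], fun z w t h => ?_, fun z _ c hc hz => ?_⟩
  · rw [← range_eq_univ]
    refine IsClopen.eq_univ ⟨?_, ?_⟩ ⟨_, mem_range_self 0⟩
    · refine isClosed_of_closure_subset fun Q hQ => ?_
      obtain ⟨_, ⟨t, rfl⟩, ⟨z, hz⟩⟩ := mem_closure_iff_nhds.1 hQ _ (hnhds Q)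
      refine ⟨z + -t, ?_⟩
      simp only at hz ⊢
      rw [hπadd, hz, ← Function.comp_apply (f := Φ (-t)), ← hΦadd, neg_add_cancel, hΦ0]
      rfl
    · refine isOpen_iff_mem_nhds.2 ?_
      rintro _ ⟨z, rfl⟩
      refine mem_of_superset (hnhds (Φ z O)) ?_
      rintro _ ⟨t, rfl⟩
      exact ⟨z + t, hπadd z t⟩
  · simp only at h ⊢
    rw [hπadd, hπadd, h]
  · filter_upwards [hflow (Φ z O) c hc hz] with t ht
    rw [← ht]; exact hπadd z t

end Translation

end RiemannSurface

namespace RiemannSurface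

open Filter Set Metric
open scoped Topology

/-! ### Uniformization by a differential without zeros -/

section Uniformization

variable {X : Type*} [TopologicalSpace X] [ChartedSpace ℂ X]

/-- In the chart `c`, the differential `η` is `dz`. -/
def IsFlatChart (η : CovectorField X) (c : OpenPartialHomeomorph X ℂ) : Prop :=
  ∀ e ∈ atlas ℂ X, ∀ z ∈ c.target, c.symm z ∈ e.source →
    HasDerivAt (e ∘ c.symm) (coeff η e (e (c.symm z)))⁻¹ z

theorem exists_isFlatChart [IsManifold 𝓘(ℂ) ω X] {η : CovectorField X}
    (hη : η ∈ holomorphicDifferentials X)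
    (h0 : ∀ e ∈ atlas ℂ X, ∀ z ∈ e.target, coeff η e z ≠ 0) (Q : X) :
    ∃ c, IsFlatChart η c ∧ Q ∈ c.source := by
  have hea := chart_mem_atlas ℂ Q
  have hQ := mem_chart_source ℂ Q
  set e := chartAt ℂ Q
  have hQt := e.map_source hQ
  obtain ⟨ρ, hρ, hρt⟩ := Metric.isOpen_iff.1 e.open_target (e Q) hQt
  obtain ⟨F, hF⟩ := DifferentiableOn.isExactOn_ball ((hη e hea).mono hρt)
  have hFa : AnalyticAt ℂ F (e Q) := by
    refine DifferentiableOn.analyticAt (s := ball (e Q) ρ) (fun z hz => ?_)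
      (ball_mem_nhds _ hρ)
    exact (hF z hz).differentiableAt.differentiableWithinAt
  have hstr : HasStrictDerivAt F (coeff η e (e Q)) (e Q) :=
    (hFa.contDiffAt (n := 1)).hasStrictDerivAt' (hF _ (mem_ball_self hρ)) (by simp)
  have hstr' := hstr.hasStrictFDerivAt_equiv (h0 e hea _ hQt)
  set R := (hstr'.toOpenPartialHomeomorph F).restrOpen (ball (e Q) ρ) isOpen_ball with hR
  have hRF : ∀ z, R z = F z := fun z => rfl
  have hRs : R.source ⊆ ball (e Q) ρ := fun z hz => by
    rw [hR, OpenPartialHomeomorph.restrOpen_source] at hz; exact hz.2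
  have hRQ : e Q ∈ R.source := by
    rw [hR, OpenPartialHomeomorph.restrOpen_source]
    exact ⟨hstr'.mem_toOpenPartialHomeomorph_source, mem_ball_self hρ⟩
  refine ⟨e.trans R, ?_, ?_⟩
  · intro e' he' z hz hz'
    rw [OpenPartialHomeomorph.trans_target] at hz
    have hzR : z ∈ R.target := hz.1
    have hwt : R.symm z ∈ e.target := hz.2
    have hwb : R.symm z ∈ ball (e Q) ρ := hRs (R.map_target hzR)
    have hz'' : e.symm (R.symm z) ∈ e'.source := hz'
    have d1 : HasDerivAt R.symm (coeff η e (R.symm z))⁻¹ z :=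
      R.hasDerivAt_symm hzR (h0 e hea _ hwt) (hF _ hwb)
    have d2 := (differentiableAt_transition hea he' hwt hz'').hasDerivAt
    have d3 := d2.comp z d1
    have hc := coeff_transition η hea he' hwt hz''
    refine d3.congr_deriv ?_
    have hd := deriv_transition_ne_zero hea he' hwt hz''
    have hc' := h0 e' he' _ (e'.map_source hz'')
    rw [hc]
    change _ = (coeff η e' (e' (e.symm (R.symm z))))⁻¹
    field_simp
  · rw [OpenPartialHomeomorph.trans_source]
    exact ⟨hQ, hRQ⟩

theorem IsFlatChart.eventually_symm_eq {η : CovectorField X}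
    (h0 : ∀ e ∈ atlas ℂ X, ∀ z ∈ e.target, coeff η e z ≠ 0) {c c' : OpenPartialHomeomorph X ℂ}
    (hc : IsFlatChart η c) (hc' : IsFlatChart η c') {Q : X} (hQ : Q ∈ c.source)
    (hQ' : Q ∈ c'.source) : ∀ᶠ t in 𝓝 (0 : ℂ), c.symm (c Q + t) = c'.symm (c' Q + t) := by
  have hsQ := c.left_inv hQ
  have hct := c.map_source hQ
  have hev : ∀ᶠ z in 𝓝 (c Q), z ∈ c.target ∧ c.symm z ∈ c'.source :=
    Eventually.and (c.open_target.mem_nhds hct)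
      ((c.continuousAt_symm hct).eventually (c'.open_source.mem_nhds (by rwa [hsQ])))
  have hd : ∀ᶠ z in 𝓝 (c Q), HasDerivAt (c' ∘ c.symm) 1 z := by
    filter_upwards [hev] with z hz
    set P := c.symm z
    have hea := chart_mem_atlas ℂ P
    have hP := mem_chart_source ℂ P
    set e := chartAt ℂ P
    have hPt := e.map_source hP
    have hsP := e.left_inv hP
    have hcs' : c'.symm (c' P) = P := c'.left_inv hz.2
    have d1 := hc e hea z hz.1 hP
    have d2 := hc' e hea (c' P) (c'.map_source hz.2) (by rwa [hcs'])
    rw [hcs'] at d2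
    have hne := h0 e hea (e P) hPt
    have d3 : HasDerivAt (c' ∘ e.symm) ((coeff η e (e P))⁻¹)⁻¹ (e P) := by
      have hcont : ContinuousAt (c' ∘ e.symm) (e P) := by
        refine ContinuousAt.comp ?_ (e.continuousAt_symm hPt)
        rw [hsP]; exact c'.continuousAt hz.2
      refine HasDerivAt.of_local_left_inverse hcont (f := e ∘ c'.symm) ?_ (inv_ne_zero hne) ?_
      · simpa only [Function.comp_apply, hsP] using d2
      · filter_upwards [e.open_target.mem_nhds hPt, (e.continuousAt_symm hPt).eventually
          (c'.open_source.mem_nhds (by rw [hsP]; exact hz.2))] with w h1 h2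
        simp [c'.left_inv h2, e.right_inv h1]
    have d4 : HasDerivAt ((c' ∘ e.symm) ∘ (e ∘ c.symm)) _ z := HasDerivAt.comp z d3 d1
    rw [inv_inv, mul_inv_cancel₀ hne] at d4
    refine d4.congr_of_eventuallyEq ?_
    filter_upwards [(c.continuousAt_symm hz.1).eventually (e.open_source.mem_nhds hP)] with w hw
    simp [e.left_inv hw]
  have h1 := (eventually_add_iff (c Q)).2 ((eventually_eq_add_of_hasDerivAt_one hd).and hev)
  filter_upwards [h1] with t ht
  obtain ⟨h2, h3, h4⟩ := ht
  simp only [Function.comp_apply, hsQ, add_sub_cancel_left] at h2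
  rw [← h2, c'.left_inv h4]

/-- `π` is a map of the plane onto `X` with `π^* η = dz`, with fibres the cosets of a group. -/
structure IsUniformization (η : CovectorField X) (O : X) (π : ℂ → X) : Prop where
  surjective : Function.Surjective π
  map_zero : π 0 = O
  congr_add : ∀ z w t, π z = π w → π (z + t) = π (w + t)
  continuous : Continuous π
  hasDerivAt : ∀ e ∈ atlas ℂ X, ∀ z, π z ∈ e.source →
    HasDerivAt (e ∘ π) (coeff η e (e (π z)))⁻¹ z

theorem exists_isUniformization [T2Space X] [CompactSpace X] [ConnectedSpace X]
    [IsManifold 𝓘(ℂ) ω X] {η : CovectorField X} (hη : η ∈ holomorphicDifferentials X)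
    (h0 : ∀ e ∈ atlas ℂ X, ∀ z ∈ e.target, coeff η e z ≠ 0) (O : X) :
    ∃ π, IsUniformization η O π := by
  have cov : ∀ Q : X, ∃ c ∈ {c | IsFlatChart η c}, Q ∈ c.source := exists_isFlatChart hη h0
  obtain ⟨π, hs, hz, hadd, hfl⟩ := exists_orbit_map cov
    (fun c hc c' hc' Q hQ hQ' => IsFlatChart.eventually_symm_eq h0 hc hc' hQ hQ') O
  refine ⟨π, hs, hz, hadd, continuous_iff_continuousAt.2 fun z =>
    hfl.continuousAt cov (mem_univ z), fun e he z hze => ?_⟩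
  obtain ⟨c, hc, hcz⟩ := cov (π z)
  have h1 := hc e he (c (π z)) (c.map_source hcz) (by rwa [c.left_inv hcz])
  rw [c.left_inv hcz] at h1
  have h2 : HasDerivAt (fun w => c (π z) + (w - z)) 1 z :=
    ((hasDerivAt_id' z).sub_const z).const_add _
  have h3 : HasDerivAt ((e ∘ c.symm) ∘ fun w => c (π z) + (w - z)) _ z :=
    HasDerivAt.comp z (by simpa using h1) h2
  rw [mul_one] at h3
  refine h3.congr_of_eventuallyEq ?_
  filter_upwards [(tendsto_add_nhds_zero z).eventually (hfl z (mem_univ z) c hc hcz)] with w hw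
  simp [← hw]

variable {η : CovectorField X} {O : X} {π : ℂ → X}

namespace IsUniformization

theorem map_eq_iff (h : IsUniformization η O π) {z w : ℂ} : π z = π w ↔ π (z - w) = O := by
  rw [← h.map_zero]
  constructor
  · intro hzw
    simpa [sub_eq_add_neg] using h.congr_add z w (-w) hzw
  · intro hzw
    simpa using h.congr_add _ _ w hzw

theorem map_add_of_period (h : IsUniformization η O π) {l : ℂ} (hl : π l = O) (z : ℂ) :
    π (z + l) = π z := by
  have := h.congr_add l 0 z (by rw [hl, h.map_zero])
  rwa [zero_add, add_comm] at this

/-- The group of periods. -/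
def periods (h : IsUniformization η O π) : AddSubgroup ℂ where
  carrier := {l | π l = O}
  zero_mem' := h.map_zero
  add_mem' := fun {a b} ha hb => (h.map_add_of_period hb a).trans ha
  neg_mem' := fun {a} ha => by
    have h1 : π (0 - a) = O := h.map_eq_iff.1 (by rw [h.map_zero]; exact (Eq.symm ha))
    simpa using h1

theorem mem_periods (h : IsUniformization η O π) {l : ℂ} : l ∈ h.periods ↔ π l = O := Iff.rfl

theorem analyticAt (h : IsUniformization η O π) {e : OpenPartialHomeomorph X ℂ}
    (he : e ∈ atlas ℂ X) {z : ℂ} (hz : π z ∈ e.source) : AnalyticAt ℂ (e ∘ π) z := by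
  rw [Complex.analyticAt_iff_eventually_differentiableAt]
  filter_upwards [h.continuous.continuousAt.eventually (e.open_source.mem_nhds hz)] with w hw
  exact (h.hasDerivAt e he w hw).differentiableAt

/-- `π` is injective near every point. -/
theorem exists_injOn (h : IsUniformization η O π)
    (h0 : ∀ e ∈ atlas ℂ X, ∀ z ∈ e.target, coeff η e z ≠ 0) :
    ∃ r > 0, ∀ z, InjOn π (ball z r) := by
  have hea := chart_mem_atlas ℂ (π 0)
  have hs := mem_chart_source ℂ (π 0)
  set e := chartAt ℂ (π 0)
  have ha := h.analyticAt hea hs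
  have hd := h.hasDerivAt e hea 0 hs
  have hstr : HasStrictDerivAt (e ∘ π) _ 0 :=
    (ha.contDiffAt (n := 1)).hasStrictDerivAt' hd (by simp)
  have hstr' := hstr.hasStrictFDerivAt_equiv (inv_ne_zero (h0 e hea _ (e.map_source hs)))
  obtain ⟨ρ, hρ, hρs⟩ := Metric.isOpen_iff.1 (hstr'.toOpenPartialHomeomorph _).open_source 0
    hstr'.mem_toOpenPartialHomeomorph_source
  refine ⟨ρ / 2, half_pos hρ, fun z v hv w hw hvw => ?_⟩
  have h1 := h.map_eq_iff.1 hvw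
  rw [← h.map_zero] at h1
  have h2 : v - w ∈ ball (0 : ℂ) ρ := by
    rw [mem_ball, dist_eq_norm] at hv hw ⊢
    have : v - w - 0 = (v - z) - (w - z) := by ring
    rw [this]
    exact (norm_sub_le _ _).trans_lt (by linarith)
  have h3 := (hstr'.toOpenPartialHomeomorph _).injOn (hρs h2) (hρs (mem_ball_self hρ))
    (by simp [h1])
  exact sub_eq_zero.1 h3

theorem isOpenMap (h : IsUniformization η O π)
    (h0 : ∀ e ∈ atlas ℂ X, ∀ z ∈ e.target, coeff η e z ≠ 0) : IsOpenMap π := by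
  rw [isOpenMap_iff_nhds_le]
  intro z
  have hea := chart_mem_atlas ℂ (π z)
  have hs := mem_chart_source ℂ (π z)
  set e := chartAt ℂ (π z)
  have ha := h.analyticAt hea hs
  have hd := h.hasDerivAt e hea z hs
  have hstr : HasStrictDerivAt (e ∘ π) _ z :=
    (ha.contDiffAt (n := 1)).hasStrictDerivAt' hd (by simp)
  have hm := hstr.map_nhds_eq (inv_ne_zero (h0 e hea _ (e.map_source hs)))
  have hs' : map e.symm (𝓝 (e (π z))) = 𝓝 (π z) := by
    have := e.symm.map_nhds_eq (e.map_source hs)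
    rwa [e.left_inv hs] at this
  rw [← hs', ← show map (e ∘ π) (𝓝 z) = 𝓝 (e (π z)) from hm, map_map]
  refine le_of_eq (Filter.map_congr ?_)
  filter_upwards [h.continuous.continuousAt.eventually (e.open_source.mem_nhds hs)] with w hw
  simp [e.left_inv hw]

/-- The plane is covered by the translates of a disc by periods. -/
theorem exists_radius [CompactSpace X] (h : IsUniformization η O π)
    (h0 : ∀ e ∈ atlas ℂ X, ∀ z ∈ e.target, coeff η e z ≠ 0) :
    ∃ R : ℝ, ∀ z, ∃ w, ‖w‖ ≤ R ∧ π w = π z := by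
  obtain ⟨t, ht⟩ := isCompact_univ.elim_directed_cover (fun n : ℕ => π '' ball 0 n)
    (fun n => h.isOpenMap h0 _ isOpen_ball) (fun Q _ => by
      obtain ⟨z, rfl⟩ := h.surjective Q
      obtain ⟨n, hn⟩ := exists_nat_gt ‖z‖
      exact mem_iUnion.2 ⟨n, z, by simpa using hn, rfl⟩)
    (Monotone.directed_le fun n m hnm => image_mono (ball_subset_ball (Nat.cast_le.2 hnm)))
  refine ⟨t, fun z => ?_⟩
  obtain ⟨w, hw, hwz⟩ := ht (mem_univ (π z))
  exact ⟨w, by simpa using (mem_ball_zero_iff.1 hw).le, hwz⟩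

end IsUniformization

end Uniformization

end RiemannSurface

namespace RiemannSurface

open Filter Set Metric
open scoped Topology

/-! ### The Green function on the uniformizing plane -/

theorem logSing_of_laplacian {v u : ℂ → ℝ} {z₀ : ℂ} {n κ : ℝ} (hu : ContDiffAt ℝ 2 u z₀)
    (hv : ∀ᶠ z in 𝓝[≠] z₀, v z = n * Real.log ‖z - z₀‖ + u z)
    (hΔ : ∀ᶠ z in 𝓝[≠] z₀, ContDiffAt ℝ 2 v z ∧ Laplacian.laplacian v z = κ) :
    LogSing v z₀ n κ := by
  refine ⟨u, hu, hv, ?_⟩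
  have hv' : ∀ᶠ z in 𝓝[≠] z₀, ∀ᶠ w in 𝓝 z, v w = n * Real.log ‖w - z₀‖ + u w := by
    rw [eventually_nhdsWithin_iff] at hv ⊢
    filter_upwards [hv.eventually_nhds] with z h1 h2
    filter_upwards [h1, isOpen_ne.mem_nhds h2] with w h3 h4 using h3 h4
  filter_upwards [hv', hΔ, self_mem_nhdsWithin] with z h1 h2 hz
  have hh : InnerProductSpace.HarmonicAt (fun w => Real.log ‖w - z₀‖) z :=
    AnalyticAt.harmonicAt_log_norm (f := fun w => w - z₀) (by fun_prop) (sub_ne_zero.2 hz)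
  have hh' := hh.const_smul (c := n)
  have he : u =ᶠ[𝓝 z] v - n • fun w => Real.log ‖w - z₀‖ := by
    filter_upwards [h1] with w hw
    simp [hw]
  rw [InnerProductSpace.laplacian_congr_nhds he |>.eq_of_nhds, h2.1.laplacian_sub hh'.1, h2.2,
    hh'.2.eq_of_nhds]
  simp

section Green

variable {X : Type*} [TopologicalSpace X] [ChartedSpace ℂ X]

theorem contDiffAt_of_contMDiffAt_prod {F : X × X → ℝ} {n : WithTop ℕ∞} {P Q : X}
    (hF : ContMDiffAt (𝓘(ℝ, ℂ).prod 𝓘(ℝ, ℂ)) 𝓘(ℝ, ℝ) n F (P, Q)) :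
    ContDiffAt ℝ n (fun w => F (P, (chartAt ℂ Q).symm w)) (chartAt ℂ Q Q) := by
  have h := (contMDiffAt_iff.1 hF).2
  simp only [mfld_simps] at h
  have h' : ContDiffAt ℝ n (F ∘ fun p : ℂ × ℂ => ((chartAt ℂ P).symm p.1, (chartAt ℂ Q).symm p.2))
      (chartAt ℂ P P, chartAt ℂ Q Q) := by
    rw [← contDiffWithinAt_univ]
    rw [Prod.map_id, range_id] at h
    exact h
  have h2 : ContDiffAt ℝ n (fun w : ℂ => (chartAt ℂ P P, w)) (chartAt ℂ Q Q) := by fun_prop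
  have h3 := ContDiffAt.comp (chartAt ℂ Q Q) h' h2
  refine h3.congr_of_eventuallyEq (Eventually.of_forall fun w => ?_)
  simp [(chartAt ℂ P).left_inv (mem_chart_source ℂ P)]

variable {G : X → X → ℝ} {η : CovectorField X} {O : X} {π : ℂ → X}

/-- The differential equation `∂∂̄ log G(P,·)² = 2πi μ`. -/
def GreenEquation (G : X → X → ℝ) (η : CovectorField X) : Prop :=
  ∀ P, ∀ e ∈ atlas ℂ X, ∀ z ∈ e.target, e.symm z ≠ P →
    ddbarCoeff (fun w => Real.log (G P (e.symm w) ^ 2)) z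
      = 2 * Real.pi * Complex.I * formCoeff η e z

theorem GreenEquation.laplacian_eq (hc : GreenEquation G η) {P : X}
    {e : OpenPartialHomeomorph X ℂ} (he : e ∈ atlas ℂ X) {z : ℂ} (hz : z ∈ e.target)
    (hP : e.symm z ≠ P) :
    Laplacian.laplacian (fun w => Real.log (G P (e.symm w) ^ 2)) z
      = -(4 * Real.pi) * ‖coeff η e z‖ ^ 2 := by
  have h := hc P e he z hz hP
  simp only [ddbarCoeff, formCoeff, Complex.mul_conj] at h
  have h2 : ((Laplacian.laplacian (fun w => Real.log (G P (e.symm w) ^ 2)) z : ℝ) : ℂ)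
      = ((-(4 * Real.pi) * ‖coeff η e z‖ ^ 2 : ℝ) : ℂ) := by
    rw [← Complex.normSq_eq_norm_sq]
    push_cast
    linear_combination 4 * h + 4 * (Real.pi * Complex.normSq (coeff η e z)) * Complex.I_mul_I
  exact_mod_cast h2

theorem IsArakelovGreenFunction.contDiffAt_log [MeasurableSpace X] (hG : IsArakelovGreenFunction G)
    (hc : GreenEquation G η) (h : IsUniformization η O π)
    (h0 : ∀ e ∈ atlas ℂ X, ∀ z ∈ e.target, coeff η e z ≠ 0) {a z : ℂ} (hz : π z ≠ π a) :
    ContDiffAt ℝ 2 (fun z => Real.log (G (π a) (π z))) z ∧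
      Laplacian.laplacian (fun z => Real.log (G (π a) (π z))) z = -(2 * Real.pi) := by
  have hea := chart_mem_atlas ℂ (π z)
  have hs := mem_chart_source ℂ (π z)
  have hsm := contDiffAt_of_contMDiffAt_prod (hG.smooth_sq (π a, π z))
  set e := chartAt ℂ (π z)
  have hzt := e.map_source hs
  have hinv := e.left_inv hs
  simp only at hsm
  have hpos : G (π a) (e.symm (e (π z))) ^ 2 ≠ 0 := by
    rw [hinv]
    exact pow_ne_zero _ fun h => hz ((hG.eq_zero_iff _ _).1 h).symm
  have hf : ContDiffAt ℝ 2 (fun w => Real.log (G (π a) (e.symm w) ^ 2)) ((e ∘ π) z) :=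
    (show ContDiffAt ℝ 2 _ _ from contDiffAt_infty.1 hsm 2).log hpos
  have hk := h.analyticAt hea hs
  have hcomp := hf.comp z (hk.contDiffAt.restrict_scalars ℝ)
  have heq : (fun z => Real.log (G (π a) (π z))) =ᶠ[𝓝 z]
      (1 / 2 : ℝ) • ((fun w => Real.log (G (π a) (e.symm w) ^ 2)) ∘ (e ∘ π)) := by
    filter_upwards [h.continuous.continuousAt.eventually (e.open_source.mem_nhds hs)] with w hw
    simp [e.left_inv hw]
  refine ⟨ContDiffAt.congr_of_eventuallyEq (hcomp.const_smul (1 / 2 : ℝ)) heq, ?_⟩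
  rw [InnerProductSpace.laplacian_congr_nhds heq |>.eq_of_nhds,
    InnerProductSpace.laplacian_smul _ hcomp, laplacian_comp_analyticAt hk hf,
    Function.comp_apply, hc.laplacian_eq hea hzt (by rwa [hinv]), (h.hasDerivAt e hea z hs).deriv]
  have hne : ‖coeff η e (e (π z))‖ ≠ 0 := norm_ne_zero_iff.2 (h0 e hea _ hzt)
  simp only [norm_inv, smul_eq_mul]
  field_simp
  norm_num

theorem eventually_map_ne (h : IsUniformization η O π)
    (h0 : ∀ e ∈ atlas ℂ X, ∀ z ∈ e.target, coeff η e z ≠ 0) (z : ℂ) :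
    ∀ᶠ w in 𝓝[≠] z, π w ≠ π z := by
  obtain ⟨r, hr, hinj⟩ := h.exists_injOn h0
  filter_upwards [mem_nhdsWithin_of_mem_nhds (ball_mem_nhds z hr), self_mem_nhdsWithin]
    with w h1 h2 h3
  exact h2 (hinj z h1 (mem_ball_self hr) h3)

theorem IsArakelovGreenFunction.logSing [MeasurableSpace X] (hG : IsArakelovGreenFunction G)
    (hc : GreenEquation G η) (h : IsUniformization η O π)
    (h0 : ∀ e ∈ atlas ℂ X, ∀ z ∈ e.target, coeff η e z ≠ 0) [T2Space X] (a z₀ : ℂ)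
    [Decidable (π z₀ = π a)] :
    LogSing (fun z => Real.log (G (π a) (π z))) z₀ (if π z₀ = π a then 1 else 0)
      (-(2 * Real.pi)) := by
  by_cases hz : π z₀ = π a
  swap
  · rw [if_neg hz]
    refine logSing_of_laplacian (hG.contDiffAt_log hc h h0 hz).1
      (Eventually.of_forall fun z => by simp) ?_
    refine Eventually.filter_mono nhdsWithin_le_nhds ?_
    filter_upwards [h.continuous.continuousAt.eventually (isOpen_ne.mem_nhds hz)] with z hz
    exact hG.contDiffAt_log hc h h0 hz
  rw [if_pos hz, ← hz]
  have hea := chart_mem_atlas ℂ (π z₀)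
  have hs := mem_chart_source ℂ (π z₀)
  have hcont : ∀ {F : X × X → ℝ} {n : WithTop ℕ∞}, ContMDiffAt (𝓘(ℝ, ℂ).prod 𝓘(ℝ, ℂ)) 𝓘(ℝ, ℝ) n
    F (π z₀, π z₀) → _ := fun hF => contDiffAt_of_contMDiffAt_prod hF
  set e := chartAt ℂ (π z₀)
  have hzt := e.map_source hs
  have hinv := e.left_inv hs
  obtain ⟨u, hu, hGu⟩ := hG.multiplicity_one e hea
  have hum := hcont (hu.contMDiffAt
    ((e.open_source.prod e.open_source).mem_nhds (show (π z₀, π z₀) ∈ _ from ⟨hs, hs⟩)))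
  have hk := h.analyticAt hea hs
  have hkd : deriv (e ∘ π) z₀ ≠ 0 := by
    rw [(h.hasDerivAt e hea z₀ hs).deriv]
    exact inv_ne_zero (h0 e hea _ hzt)
  have hv2 : ContDiffAt ℝ 2 (fun z => Real.log (u (π z₀, e.symm ((e ∘ π) z)))) z₀ := by
    have h1 : ContDiffAt ℝ 2 (fun w => Real.log (u (π z₀, e.symm w))) ((e ∘ π) z₀) := by
      refine (show ContDiffAt ℝ 2 _ _ from contDiffAt_infty.1 hum 2).log ?_
      rw [hinv]
      exact (hGu _ hs _ hs).1.ne'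
    exact h1.comp z₀ (hk.contDiffAt.restrict_scalars ℝ)
  have hord : meromorphicOrderAt (fun z => (e ∘ π) z - (e ∘ π) z₀) z₀ = ((1 : ℤ) : WithTop ℤ) := by
    have ha : AnalyticAt ℂ (fun z => (e ∘ π) z - (e ∘ π) z₀) z₀ := hk.sub analyticAt_const
    rw [ha.meromorphicOrderAt_eq,
      hk.analyticOrderAt_sub_eq_one_of_deriv_ne_zero hkd]
    rfl
  obtain ⟨u₁, hu₁, h1, -⟩ := LogSing.log_norm
    (f := fun z => (e ∘ π) z - (e ∘ π) z₀) (hk.sub analyticAt_const).meromorphicAt hord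
  have hne := eventually_map_ne h h0 z₀
  refine logSing_of_laplacian (hu₁.add hv2) ?_ ?_
  · filter_upwards [h1, hne, mem_nhdsWithin_of_mem_nhds
      (h.continuous.continuousAt.preimage_mem_nhds (e.open_source.mem_nhds hs))] with z h2 h3 h4
    have h5 := hGu _ hs _ h4
    have h6 : ‖e (π z) - e (π z₀)‖ ≠ 0 := by
      rw [norm_ne_zero_iff, sub_ne_zero]
      exact fun h => h3 (e.injOn h4 hs h)
    simp only [Function.comp_apply, Int.cast_one, one_mul] at h2 ⊢
    rw [h5.2, norm_sub_rev, Real.log_mul h6 h5.1.ne', h2, e.left_inv h4]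
    ring
  · filter_upwards [hne] with z hz
    exact hG.contDiffAt_log hc h h0 hz

end Green

end RiemannSurface

namespace RiemannSurface

open Filter Set Metric
open scoped Topology

/-! ### The area measure on the uniformizing plane -/

theorem det_mul_complex (c : ℂ) : (ContinuousLinearMap.mul ℝ ℂ c).det = ‖c‖ ^ 2 := by
  have h := Algebra.norm_complex_apply c
  rw [Algebra.norm_apply] at h
  rw [← Complex.normSq_eq_norm_sq, ← h]
  rfl

theorem measure_eq_iSup_restrict {X : Type*} [MeasurableSpace X] {ι : Type*} (m : Measure X)
    (S : ι → Set X) (hS : ∀ i, MeasurableSet (S i)) (f : ℕ → ι) (hf : ⋃ n, S (f n) = univ) :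
    ⨆ i, m.restrict (S i) = m := by
  refine le_antisymm (iSup_le fun i => Measure.restrict_le_self) ?_
  set s := ⨆ i, m.restrict (S i)
  have hle : ∀ i, m.restrict (S i) ≤ s := fun i => le_iSup (fun i => m.restrict (S i)) i
  set D := disjointed fun n => S (f n)
  have hD : ∀ n, MeasurableSet (D n) := fun n => MeasurableSet.disjointed (fun n => hS _) n
  have hU : ⋃ n, D n = univ := by rw [iUnion_disjointed, hf]
  refine Measure.le_iff.2 fun A hA => ?_
  have key : ∀ μ : Measure X, μ A = ∑' n, μ (A ∩ D n) := by
    intro μ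
    rw [← measure_iUnion ?_ fun n => hA.inter (hD n), ← inter_iUnion, hU, inter_univ]
    exact fun i j hij => (disjoint_disjointed _ hij).mono inter_subset_right inter_subset_right
  rw [key m, key s]
  refine ENNReal.tsum_le_tsum fun n => ?_
  have h1 : m (A ∩ D n) = m.restrict (S (f n)) (A ∩ D n) := by
    rw [Measure.restrict_apply (hA.inter (hD n)), inter_eq_self_of_subset_left
      (show A ∩ D n ⊆ S (f n) from inter_subset_right.trans (disjointed_subset _ n))]
  rw [h1]
  exact hle _ _

section Area

variable {X : Type*} [TopologicalSpace X] [ChartedSpace ℂ X]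
  {η : CovectorField X} {O : X} {π : ℂ → X}

/-- `F` is a measurable set of representatives of the points of `X`. -/
structure IsFundamentalSet (π : ℂ → X) (F : Set ℂ) : Prop where
  measurableSet : MeasurableSet F
  injOn : InjOn π F
  image_eq : π '' F = univ

theorem IsUniformization.exists_isFundamentalSet (h : IsUniformization η O π)
    (h0 : ∀ e ∈ atlas ℂ X, ∀ z ∈ e.target, coeff η e z ≠ 0) : ∃ F, IsFundamentalSet π F := by
  obtain ⟨r, hr, hinj⟩ := h.exists_injOn h0
  set B : ℕ → Set ℂ := fun n => ball (TopologicalSpace.denseSeq ℂ n) r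
  have hBo : ∀ n, IsOpen (B n) := fun n => isOpen_ball
  set D : ℕ → Set ℂ := fun n => B n \ ⋃ m < n, π ⁻¹' (π '' B m)
  refine ⟨⋃ n, D n, ?_, ?_, ?_⟩
  · refine MeasurableSet.iUnion fun n => (hBo n).measurableSet.diff ?_
    refine (isOpen_iUnion fun m => isOpen_iUnion fun _ => ?_).measurableSet
    exact (h.isOpenMap h0 _ (hBo m)).preimage h.continuous
  · have hlt : ∀ n m z w, n < m → z ∈ D n → w ∈ D m → π z ≠ π w := by
      intro n m z w hnm hz hw hzw
      refine hw.2 (mem_iUnion₂.2 ⟨n, hnm, z, hz.1, hzw⟩)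
    intro z hz w hw hzw
    obtain ⟨n, hn⟩ := mem_iUnion.1 hz
    obtain ⟨m, hm⟩ := mem_iUnion.1 hw
    rcases lt_trichotomy n m with hnm | rfl | hnm
    · exact absurd hzw (hlt n m z w hnm hn hm)
    · exact hinj _ hn.1 hm.1 hzw
    · exact absurd hzw.symm (hlt m n w z hnm hm hn)
  · refine eq_univ_of_forall fun Q => ?_
    have hex : ∃ n, Q ∈ π '' B n := by
      obtain ⟨z, rfl⟩ := h.surjective Q
      obtain ⟨n, hn⟩ := (TopologicalSpace.denseRange_denseSeq ℂ).exists_dist_lt z hr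
      exact ⟨n, z, hn, rfl⟩
    classical
    obtain ⟨z, hz, hzQ⟩ := Nat.find_spec hex
    refine ⟨z, mem_iUnion.2 ⟨Nat.find hex, hz, ?_⟩, hzQ⟩
    intro hmem
    obtain ⟨m, hm, hm'⟩ := mem_iUnion₂.1 hmem
    rw [mem_preimage, hzQ] at hm'
    exact Nat.find_min hex hm hm'

theorem IsUniformization.areaMeasure_eq [CompactSpace X] [MeasurableSpace X]
    [BorelSpace X] (h : IsUniformization η O π)
    (h0 : ∀ e ∈ atlas ℂ X, ∀ z ∈ e.target, coeff η e z ≠ 0) {F : Set ℂ}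
    (hF : IsFundamentalSet π F) : areaMeasure η = Measure.map π (volume.restrict F) := by
  set m := Measure.map π (volume.restrict F)
  have hν : ∀ p : X, Measure.map (chartAt ℂ p).symm
      ((volume.restrict (chartAt ℂ p).target).withDensity
      fun z => ENNReal.ofReal (‖coeff η (chartAt ℂ p) z‖ ^ 2)) =
      m.restrict (chartAt ℂ p).source := by
    intro p
    have hea := chart_mem_atlas ℂ p
    set e := chartAt ℂ p
    have hae : AEMeasurable e.symm ((volume.restrict e.target).withDensity
        fun z => ENNReal.ofReal (‖coeff η e z‖ ^ 2)) :=
      (e.continuousOn_symm.aemeasurable e.open_target.measurableSet).mono_ac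
        (withDensity_absolutelyContinuous _ _)
    ext A hA
    rw [Measure.map_apply_of_aemeasurable hae hA, withDensity_apply',
      Measure.restrict_restrict' e.open_target.measurableSet, Measure.restrict_apply hA]
    have hAs : MeasurableSet (A ∩ e.source) := hA.inter e.open_source.measurableSet
    rw [Measure.map_apply h.continuous.measurable hAs,
      Measure.restrict_apply (h.continuous.measurable hAs)]
    set S := π ⁻¹' (A ∩ e.source) ∩ F
    have hS : MeasurableSet S := (h.continuous.measurable hAs).inter hF.measurableSet
    have himg : e.symm ⁻¹' A ∩ e.target = (e ∘ π) '' S := by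
      ext w
      constructor
      · rintro ⟨h1, h2⟩
        obtain ⟨z, hz, hzw⟩ : e.symm w ∈ π '' F := by rw [hF.image_eq]; trivial
        refine ⟨z, ⟨⟨?_, ?_⟩, hz⟩, ?_⟩
        · rw [hzw]; exact h1
        · rw [hzw]; exact e.map_target h2
        · rw [Function.comp_apply, hzw, e.right_inv h2]
      · rintro ⟨z, ⟨⟨h1, h2⟩, hz⟩, rfl⟩
        refine ⟨?_, e.map_source h2⟩
        rw [mem_preimage, Function.comp_apply, e.left_inv h2]
        exact h1
    have hkinj : InjOn (e ∘ π) S := fun z hz w hw hzw =>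
      hF.injOn hz.2 hw.2 (e.injOn hz.1.2 hw.1.2 hzw)
    have hkd : ∀ z ∈ S, HasFDerivWithinAt (e ∘ π)
        (ContinuousLinearMap.mul ℝ ℂ (coeff η e (e (π z)))⁻¹) S z := by
      intro z hz
      have := ((h.hasDerivAt e hea z hz.1.2).hasFDerivAt.restrictScalars ℝ).hasFDerivWithinAt
        (s := S)
      refine this.congr_fderiv ?_
      ext
      simp [mul_comm]
    rw [himg, lintegral_image_eq_lintegral_abs_det_fderiv_mul volume hS hkd hkinj]
    rw [setLIntegral_congr_fun hS (g := fun _ => 1), setLIntegral_one]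
    intro z hz
    have hne : ‖coeff η e (e (π z))‖ ≠ 0 :=
      norm_ne_zero_iff.2 (h0 e hea _ (e.map_source hz.1.2))
    simp only [det_mul_complex, Function.comp_apply]
    rw [← ENNReal.ofReal_mul (abs_nonneg _), abs_of_nonneg (by positivity), norm_inv, ← mul_pow,
      inv_mul_cancel₀ hne]
    simp
  unfold areaMeasure
  rw [iSup_congr hν]
  obtain ⟨t, ht⟩ := isCompact_univ.elim_nhds_subcover (fun p : X => (chartAt ℂ p).source)
    (fun p _ => (chartAt ℂ p).open_source.mem_nhds (mem_chart_source ℂ p))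
  have hne : (t : Set X).Nonempty := by
    by_contra hemp
    rw [not_nonempty_iff_eq_empty, Finset.coe_eq_empty] at hemp
    subst hemp
    exact absurd (ht.2 (mem_univ O)) (by simp)
  obtain ⟨f, hf⟩ := t.countable_toSet.exists_eq_range hne
  refine measure_eq_iSup_restrict m (fun p : X => (chartAt ℂ p).source)
    (fun p => (chartAt ℂ p).open_source.measurableSet) f (eq_univ_of_forall fun Q => ?_)
  obtain ⟨p, hp, hpQ⟩ := mem_iUnion₂.1 (ht.2 (mem_univ Q))
  obtain ⟨n, rfl⟩ : p ∈ range f := by rw [← hf]; exact hp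
  exact mem_iUnion.2 ⟨n, hpQ⟩

theorem IsUniformization.countable_periods (h : IsUniformization η O π)
    (h0 : ∀ e ∈ atlas ℂ X, ∀ z ∈ e.target, coeff η e z ≠ 0) : Countable h.periods := by
  obtain ⟨r, hr, hinj⟩ := h.exists_injOn h0
  have hd : (h.periods : Set ℂ).PairwiseDisjoint fun l => ball l (r / 2) := by
    intro l hl l' hl' hne
    refine Set.disjoint_left.2 fun z hz hz' => hne ?_
    refine hinj l (mem_ball_self hr) ?_ (Eq.trans hl (Eq.symm hl'))
    rw [mem_ball] at hz hz' ⊢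
    calc dist l' l ≤ dist z l' + dist z l := dist_triangle_left _ _ _
      _ < r := by linarith
  exact (hd.countable_of_isOpen (fun l _ => isOpen_ball)
    (fun l _ => ⟨l, mem_ball_self (half_pos hr)⟩)).to_subtype

theorem IsFundamentalSet.isAddFundamentalDomain (h : IsUniformization η O π) {F : Set ℂ}
    (hF : IsFundamentalSet π F) : IsAddFundamentalDomain h.periods F volume := by
  refine IsAddFundamentalDomain.mk' hF.measurableSet.nullMeasurableSet fun z => ?_
  obtain ⟨w, hw, hwz⟩ : π z ∈ π '' F := by rw [hF.image_eq]; trivial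
  refine ⟨⟨w - z, h.map_eq_iff.1 hwz⟩, ?_, ?_⟩
  · simpa [AddSubgroup.vadd_def] using hw
  · rintro ⟨l, hl⟩ hlz
    simp only [AddSubgroup.vadd_def, vadd_eq_add] at hlz
    have h1 : π (l + z) = π w := by
      rw [hwz, add_comm]; exact h.map_add_of_period hl z
    have h2 := hF.injOn hlz hw h1
    exact Subtype.ext (by simp [← h2])

theorem IsFundamentalSet.preimage_sub (h : IsUniformization η O π) {F : Set ℂ}
    (hF : IsFundamentalSet π F) (t : ℂ) : IsFundamentalSet π ((fun z => z - t) ⁻¹' F) := by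
  refine ⟨hF.measurableSet.preimage (by fun_prop), ?_, eq_univ_of_forall fun Q => ?_⟩
  · intro z hz w hw hzw
    exact sub_left_injective (hF.injOn hz hw (by simpa [sub_eq_add_neg] using h.congr_add z w (-t) hzw))
  · obtain ⟨z, rfl⟩ := h.surjective Q
    obtain ⟨w, hw, hwz⟩ : π (z - t) ∈ π '' F := by rw [hF.image_eq]; trivial
    exact ⟨w + t, by simpa using hw, by simpa using h.congr_add _ _ t hwz⟩

variable {F : Set ℂ} {f : ℂ → ℝ}

theorem IsFundamentalSet.setIntegral_add (h : IsUniformization η O π)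
    (h0 : ∀ e ∈ atlas ℂ X, ∀ z ∈ e.target, coeff η e z ≠ 0)
    (hF : IsFundamentalSet π F) (hf : ∀ z w, π z = π w → f z = f w) (t : ℂ) :
    ∫ z in F, f (z + t) = ∫ z in F, f z := by
  have := h.countable_periods h0
  have h1 : ∫ z in F, f (z + t) = ∫ z in (fun z => z - t) ⁻¹' F, f z := by
    have hmp : MeasurePreserving (fun z : ℂ => z + t) volume volume :=
      measurePreserving_add_right volume t
    rw [← hmp.setIntegral_preimage_emb (measurableEmbedding_addRight t) f
      ((fun z => z - t) ⁻¹' F)]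
    simp [preimage_preimage]
  rw [h1]
  refine IsAddFundamentalDomain.setIntegral_eq
    ((hF.preimage_sub h t).isAddFundamentalDomain h) (hF.isAddFundamentalDomain h) ?_
  rintro ⟨l, hl⟩ z
  refine hf _ _ ?_
  simp only [AddSubgroup.vadd_def, vadd_eq_add]
  rw [add_comm]; exact h.map_add_of_period hl z

theorem IsFundamentalSet.integrableOn_add (h : IsUniformization η O π)
    (h0 : ∀ e ∈ atlas ℂ X, ∀ z ∈ e.target, coeff η e z ≠ 0)
    (hF : IsFundamentalSet π F) (hf : ∀ z w, π z = π w → f z = f w)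
    (hi : IntegrableOn f F) (t : ℂ) : IntegrableOn (fun z => f (z + t)) F := by
  have := h.countable_periods h0
  have h2 : IntegrableOn f ((fun z => z - t) ⁻¹' F) := by
    refine (IsAddFundamentalDomain.integrableOn_iff (hF.isAddFundamentalDomain h)
      ((hF.preimage_sub h t).isAddFundamentalDomain h) ?_).1 hi
    rintro ⟨l, hl⟩ z
    refine hf _ _ ?_
    simp only [AddSubgroup.vadd_def, vadd_eq_add]
    rw [add_comm]; exact h.map_add_of_period hl z
  have hmp : MeasurePreserving (fun z : ℂ => z + t) volume volume :=
    measurePreserving_add_right volume t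
  have h3 := (hmp.integrableOn_comp_preimage (measurableEmbedding_addRight t)).2 h2
  simpa [preimage_preimage, Function.comp_def] using h3

end Area

end RiemannSurface

namespace RiemannSurface

open Filter Set Metric
open scoped Topology

/-! ### Invariance properties of the Green function -/

theorem ae_of_forall_nhdsNE {p : ℂ → Prop} (h : ∀ z₀, ∀ᶠ z in 𝓝[≠] z₀, p z) : ∀ᵐ z, p z := by
  have h1 : ∀ᵐ z ∂(volume.restrict (univ : Set ℂ)), p z := by
    refine ae_restrict_le_codiscreteWithin MeasurableSet.univ ?_
    rw [mem_codiscreteWithin]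
    intro z _
    rw [disjoint_principal_right]
    filter_upwards [h z] with w hw
    simpa using hw
  simpa using h1

theorem eq_of_eventually_nhdsNE {v : ℂ → ℝ} {C : ℝ} {z₀ : ℂ} (h : ∀ᶠ z in 𝓝[≠] z₀, v z = C)
    (hv : ContinuousAt v z₀) : v z₀ = C :=
  tendsto_nhds_unique (hv.tendsto.mono_left nhdsWithin_le_nhds)
    (tendsto_const_nhds.congr' (h.mono fun _ hw => hw.symm))

section Green

variable {X : Type*} [TopologicalSpace X] [ChartedSpace ℂ X]

/-- An Arakelov-Green function, pulled back to the plane by a uniformization. -/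
structure GreenUniformization [MeasurableSpace X] (G : X → X → ℝ) (η : CovectorField X) (O : X)
    (π : ℂ → X) (F : Set ℂ) : Prop where
  unif : IsUniformization η O π
  coeff_ne_zero : ∀ e ∈ atlas ℂ X, ∀ z ∈ e.target, coeff η e z ≠ 0
  green : IsArakelovGreenFunction G
  equation : GreenEquation G η
  fundamental : IsFundamentalSet π F
  volume_eq : volume F = 1
  integrableOn : ∀ a, IntegrableOn (fun z => Real.log (G (π a) (π z))) F
  integral_eq : ∀ a, ∫ z in F, Real.log (G (π a) (π z)) = 0

theorem exists_greenUniformization [T2Space X] [CompactSpace X] [ConnectedSpace X]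
    [IsManifold 𝓘(ℂ) ω X] [MeasurableSpace X] [BorelSpace X] {G : X → X → ℝ}
    (hG : IsArakelovGreenFunction G) {α : Fin 3 → ℂ} {O : X} {x y : X → ℂ}
    (hW : IsWeierstrassEquation α O x y) :
    ∃ (η : CovectorField X) (π : ℂ → X) (F : Set ℂ) (c : ℂ), GreenUniformization G η O π F ∧
      c ≠ 0 ∧ ∀ e ∈ atlas ℂ X, ∀ z ∈ e.target, e.symm z ≠ O →
        c * deriv (x ∘ e.symm) z = y (e.symm z) * coeff η e z := by
  obtain ⟨η, hη, heq, hnorm⟩ := hG.curvature_and_normalization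
  obtain ⟨c, hc, hcη⟩ := hW.exists_mul_deriv_eq hη
  have h0 : ∀ e ∈ atlas ℂ X, ∀ z ∈ e.target, coeff η e z ≠ 0 := fun e he z hz => (hcη e he z hz).1
  obtain ⟨π, hπ⟩ := exists_isUniformization hη.1 h0 O
  obtain ⟨F, hF⟩ := hπ.exists_isFundamentalSet h0
  have harea := hπ.areaMeasure_eq h0 hF
  have hvol : volume F = 1 := by
    have := hη.2
    rw [harea, Measure.map_apply hπ.continuous.measurable MeasurableSet.univ] at this
    simpa using this
  have haem : AEMeasurable π (volume.restrict F) := hπ.continuous.measurable.aemeasurable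
  refine ⟨η, π, F, c, ⟨hπ, h0, hG, heq, hF, hvol, fun a => ?_, fun a => ?_⟩, hc,
    fun e he z hz => (hcη e he z hz).2⟩
  · have := (hnorm (π a)).1
    rw [harea] at this
    exact (integrable_map_measure this.aestronglyMeasurable haem).1 this
  · have h1 := (hnorm (π a)).1
    have h2 := (hnorm (π a)).2
    rw [harea] at h1 h2
    rwa [integral_map haem h1.aestronglyMeasurable] at h2

namespace GreenUniformization

variable [MeasurableSpace X] {G : X → X → ℝ} {η : CovectorField X} {O : X} {π : ℂ → X}
  {F : Set ℂ}

theorem continuousAt_log (h : GreenUniformization G η O π F) {a z : ℂ} (hz : π z ≠ π a) :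
    ContinuousAt (fun z => Real.log (G (π a) (π z))) z :=
  (h.green.contDiffAt_log h.equation h.unif h.coeff_ne_zero hz).1.continuousAt

theorem green_pos (h : GreenUniformization G η O π F) {P Q : X} (hPQ : P ≠ Q) : 0 < G P Q :=
  (h.green.nonneg P Q).lt_of_ne fun h' => hPQ ((h.green.eq_zero_iff P Q).1 h'.symm)

theorem isFiniteMeasure (h : GreenUniformization G η O π F) :
    IsFiniteMeasure (volume.restrict F) := ⟨by simp [h.volume_eq]⟩

theorem setIntegral_const (h : GreenUniformization G η O π F) (c : ℝ) : ∫ _ in F, c = c := by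
  simp [Measure.real, h.volume_eq]

/-- A periodic harmonic function with removable singularities is constant. -/
theorem exists_eventually_eq_const [CompactSpace X] (h : GreenUniformization G η O π F)
    {v : ℂ → ℝ} (hv : ∀ z, LogSing v z 0 0) (hper : ∀ z w, π z = π w → v z = v w) :
    ∃ C, ∀ z₀, ∀ᶠ z in 𝓝[≠] z₀, v z = C := by
  obtain ⟨R, hR⟩ := h.unif.exists_radius h.coeff_ne_zero
  refine eventually_eq_const_of_logSing hv (R := R) fun z => ?_
  obtain ⟨w, hw, hwz⟩ := hR z
  exact ⟨w, hw, fun t => hper _ _ (h.unif.congr_add _ _ _ hwz.symm)⟩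

/-- The Green function is invariant under translations. -/
theorem green_add [T2Space X] [CompactSpace X] (h : GreenUniformization G η O π F) (a b t : ℂ) :
    G (π (a + t)) (π (b + t)) = G (π a) (π b) := by
  classical
  have hiff : ∀ z w : ℂ, π (z + t) = π (w + t) ↔ π z = π w := fun z w =>
    ⟨fun hzw => by simpa using h.unif.congr_add _ _ (-t) hzw, fun hzw => h.unif.congr_add _ _ t hzw⟩
  set v : ℂ → ℝ := fun z => Real.log (G (π (a + t)) (π (z + t))) - Real.log (G (π a) (π z))
    with hvdef
  have hv : ∀ z, LogSing v z 0 0 := by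
    intro z₀
    have l1 := (h.green.logSing h.equation h.unif h.coeff_ne_zero (a + t) (1 * z₀ + t)).comp_affine
      one_ne_zero
    have l2 := h.green.logSing h.equation h.unif h.coeff_ne_zero a z₀
    have l3 := l1.sub l2
    simpa only [one_mul, hiff, sub_self, norm_one, one_pow] using l3
  have hper : ∀ z w, π z = π w → v z = v w := fun z w hzw => by
    simp only [hvdef, hzw, h.unif.congr_add z w t hzw]
  obtain ⟨C, hC⟩ := h.exists_eventually_eq_const hv hper
  have hC0 : C = 0 := by
    have h1 : ∫ z in F, v z = C := by
      rw [← h.setIntegral_const C]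
      exact integral_congr_ae (ae_restrict_of_ae (ae_of_forall_nhdsNE hC))
    have hp : ∀ z w, π z = π w →
        Real.log (G (π (a + t)) (π z)) = Real.log (G (π (a + t)) (π w)) := fun z w hzw => by
      rw [hzw]
    rw [← h1, integral_sub (h.fundamental.integrableOn_add h.unif h.coeff_ne_zero hp
        (h.integrableOn (a + t)) t) (h.integrableOn a),
      h.fundamental.setIntegral_add h.unif h.coeff_ne_zero hp t, h.integral_eq, h.integral_eq,
      sub_zero]
  by_cases hab : π b = π a
  · rw [hab, h.unif.congr_add _ _ t hab, (h.green.eq_zero_iff _ _).2 rfl,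
      (h.green.eq_zero_iff _ _).2 rfl]
  · have hab' : π (b + t) ≠ π (a + t) := fun h' => hab ((hiff _ _).1 h')
    have hcont : ContinuousAt v b := by
      refine ContinuousAt.sub ?_ (h.continuousAt_log hab)
      exact ContinuousAt.comp (g := fun z => Real.log (G (π (a + t)) (π z)))
        (f := fun z => z + t) (h.continuousAt_log hab') (by fun_prop)
    have hvb := eq_of_eventually_nhdsNE (hC b) hcont
    rw [hC0] at hvb
    exact Real.log_injOn_pos (h.green_pos hab'.symm) (h.green_pos (Ne.symm hab))
      (sub_eq_zero.1 hvb)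

theorem log_green_eq [T2Space X] [CompactSpace X] (h : GreenUniformization G η O π F) (a b : ℂ) :
    Real.log (G (π a) (π b)) = Real.log (G O (π (b - a))) := by
  rw [← h.green_add a b (-a), add_neg_cancel, h.unif.map_zero, sub_eq_add_neg]

theorem logSing_origin [T2Space X] (h : GreenUniformization G η O π F) (z₀ : ℂ)
    [Decidable (π z₀ = O)] :
    LogSing (fun z => Real.log (G O (π z))) z₀ (if π z₀ = O then 1 else 0)
      (-(2 * Real.pi)) := by
  classical
  have := h.green.logSing h.equation h.unif h.coeff_ne_zero 0 z₀
  simp only [h.unif.map_zero] at this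
  convert this

theorem continuousAt_log_origin (h : GreenUniformization G η O π F) {z : ℂ} (hz : π z ≠ O) :
    ContinuousAt (fun z => Real.log (G O (π z))) z := by
  have := h.continuousAt_log (a := 0) (z := z) (by rwa [h.unif.map_zero])
  rwa [h.unif.map_zero] at this

theorem map_neg_iff (h : GreenUniformization G η O π F) (z : ℂ) : π (-z) = O ↔ π z = O := by
  rw [← h.unif.mem_periods, ← h.unif.mem_periods, neg_mem_iff]

theorem log_green_neg [T2Space X] [CompactSpace X] (h : GreenUniformization G η O π F) (z : ℂ) :
    Real.log (G O (π (-z))) = Real.log (G O (π z)) := by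
  classical
  set v : ℂ → ℝ := fun z => Real.log (G O (π (-z))) - Real.log (G O (π z)) with hvdef
  have hv : ∀ z, LogSing v z 0 0 := by
    intro z₀
    have l1 := (h.logSing_origin ((-1) * z₀ + 0)).comp_affine (neg_ne_zero.2 one_ne_zero)
    have l3 := l1.sub (h.logSing_origin z₀)
    simpa only [neg_mul, one_mul, add_zero, h.map_neg_iff, sub_self, norm_neg, norm_one,
      one_pow] using l3
  have hper : ∀ z w, π z = π w → v z = v w := fun z w hzw => by
    have : π (-z) = π (-w) := by
      rw [h.unif.map_eq_iff] at hzw ⊢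
      rw [show -z - -w = -(z - w) by ring, h.map_neg_iff, hzw]
    simp only [hvdef, hzw, this]
  obtain ⟨C, hC⟩ := h.exists_eventually_eq_const hv hper
  have hC0 : C = 0 := by
    have ht : Tendsto (fun z : ℂ => -z) (𝓝[≠] 0) (𝓝[≠] 0) := by
      refine tendsto_nhdsWithin_of_tendsto_nhds_of_eventually_within _ ?_ ?_
      · have : Continuous fun z : ℂ => -z := by fun_prop
        simpa using (this.tendsto 0).mono_left nhdsWithin_le_nhds
      · filter_upwards [self_mem_nhdsWithin] with z hz
        simpa using hz
    obtain ⟨w, h1, h2⟩ := ((hC 0).and (ht.eventually (hC 0))).exists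
    simp only [hvdef, neg_neg] at h1 h2
    linarith
  by_cases hz : π z = O
  · rw [hz, (h.map_neg_iff z).2 hz]
  · have hcont : ContinuousAt v z := by
      refine ContinuousAt.sub ?_ (h.continuousAt_log_origin hz)
      exact ContinuousAt.comp (g := fun z => Real.log (G O (π z))) (f := fun z => -z)
        (h.continuousAt_log_origin (mt (h.map_neg_iff z).1 hz)) (by fun_prop)
    have := eq_of_eventually_nhdsNE (hC z) hcont
    rw [hC0] at this
    exact sub_eq_zero.1 this

theorem measurable_log [BorelSpace X] (h : GreenUniformization G η O π F) :
    Measurable fun z => Real.log (G O (π z)) := by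
  have h1 : Continuous fun z => G O (π z) ^ 2 :=
    h.green.smooth_sq.continuous.comp (f := fun z => (O, π z)) (by
      have := h.unif.continuous
      fun_prop)
  have h2 : (fun z => Real.log (G O (π z))) = fun z => (1 / 2) * Real.log (G O (π z) ^ 2) := by
    funext z
    rw [Real.log_pow]
    push_cast
    ring
  rw [h2]
  exact (h1.measurable.log).const_mul _

/-- The distribution relation for multiplication by two. -/
theorem log_green_two_mul [T2Space X] [CompactSpace X] [BorelSpace X]
    (h : GreenUniformization G η O π F) (T : Fin 4 → ℂ)
    (hTinj : Function.Injective (π ∘ T))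
    (hT : ∀ z, π (2 * z) = O ↔ ∃ i, π z = π (T i)) (z₀ : ℂ) :
    ∀ᶠ z in 𝓝[≠] z₀, Real.log (G O (π (2 * z))) = ∑ i, Real.log (G O (π (z - T i))) := by
  classical
  set ℓ : ℂ → ℝ := fun z => Real.log (G O (π z)) with hℓ
  have hℓper : ∀ z w, π z = π w → ℓ z = ℓ w := fun z w hzw => by simp only [hℓ, hzw]
  have hℓi : IntegrableOn ℓ F := by
    have := h.integrableOn 0
    rwa [h.unif.map_zero] at this
  have hℓ0 : ∫ z in F, ℓ z = 0 := by
    have := h.integral_eq 0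
    rwa [h.unif.map_zero] at this
  have hsub : ∀ z w t : ℂ, π z = π w → π (z - t) = π (w - t) := fun z w t hzw => by
    simpa [sub_eq_add_neg] using h.unif.congr_add z w (-t) hzw
  have hdbl : ∀ z w : ℂ, π z = π w → π (2 * z) = π (2 * w) := fun z w hzw => by
    have h1 := h.unif.map_eq_iff.1 hzw
    rw [h.unif.map_eq_iff, show 2 * z - 2 * w = (z - w) + (z - w) by ring]
    exact h.unif.periods.add_mem h1 h1
  set v : ℂ → ℝ := fun z => ℓ (2 * z) - ∑ i, ℓ (z - T i) with hvdef
  have hv : ∀ z, LogSing v z 0 0 := by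
    intro z₀
    have l1 := (h.logSing_origin (2 * z₀ + 0)).comp_affine two_ne_zero
    have l2 : ∀ i ∈ (Finset.univ : Finset (Fin 4)), LogSing (fun z => ℓ (1 * z + -T i)) z₀
        (if π (1 * z₀ + -T i) = O then 1 else 0) (‖(1 : ℂ)‖ ^ 2 * -(2 * Real.pi)) := fun i _ =>
      (h.logSing_origin (1 * z₀ + -T i)).comp_affine one_ne_zero
    have l3 := l1.sub (LogSing.sum _ l2)
    have e1 : ((if π (2 * z₀ + 0) = O then 1 else 0 : ℝ) -
        ∑ i : Fin 4, if π (1 * z₀ + -T i) = O then 1 else 0) = 0 := by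
      simp only [add_zero, one_mul, ← sub_eq_add_neg, ← h.unif.map_eq_iff]
      by_cases hz : π (2 * z₀) = O
      · obtain ⟨i, hi⟩ := (hT z₀).1 hz
        rw [if_pos hz, Finset.sum_eq_single i, if_pos hi, sub_self]
        · intro j _ hj
          rw [if_neg]
          exact fun hj' => hj (hTinj (hj'.symm.trans hi))
        · simp
      · rw [if_neg hz, Finset.sum_eq_zero, sub_self]
        intro i _
        rw [if_neg]
        exact fun hi => hz ((hT z₀).2 ⟨i, hi⟩)
    have e2 : (‖(2 : ℂ)‖ ^ 2 * -(2 * Real.pi) -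
        ∑ _i : Fin 4, ‖(1 : ℂ)‖ ^ 2 * -(2 * Real.pi)) = 0 := by
      simp
      ring
    rw [e1, e2] at l3
    simpa only [add_zero, one_mul, ← sub_eq_add_neg] using l3
  have hper : ∀ z w, π z = π w → v z = v w := fun z w hzw => by
    have h1 := hℓper _ _ (hdbl z w hzw)
    have h2 : ∀ i, ℓ (z - T i) = ℓ (w - T i) := fun i => hℓper _ _ (hsub z w (T i) hzw)
    simp only [hvdef, h1, h2]
  obtain ⟨C, hC⟩ := h.exists_eventually_eq_const hv hper
  have hfin := h.isFiniteMeasure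
  have htr : ∀ t, ∫ z in F, ℓ (z + t) = 0 := fun t => by
    rw [h.fundamental.setIntegral_add h.unif h.coeff_ne_zero hℓper t, hℓ0]
  have htri : ∀ t, IntegrableOn (fun z => ℓ (z + t)) F := fun t =>
    h.fundamental.integrableOn_add h.unif h.coeff_ne_zero hℓper hℓi t
  have heven : ∀ z w : ℂ, ℓ (2 * z - w) = ℓ (w + -(2 * z)) := fun z w => by
    rw [show 2 * z - w = -(w + -(2 * z)) by ring]
    exact h.log_green_neg _
  have hint : Integrable (fun p : ℂ × ℂ => ℓ (2 * p.1 - p.2))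
      ((volume.restrict F).prod (volume.restrict F)) := by
    have hm : Measurable fun p : ℂ × ℂ => ℓ (2 * p.1 - p.2) :=
      h.measurable_log.comp (by fun_prop)
    rw [integrable_prod_iff hm.aestronglyMeasurable]
    refine ⟨Eventually.of_forall fun z => ?_, ?_⟩
    · simp only [heven]
      exact htri _
    · have : ∀ z : ℂ, ∫ w in F, ‖ℓ (2 * z - w)‖ = ∫ w in F, ‖ℓ w‖ := fun z => by
        simp only [heven]
        exact h.fundamental.setIntegral_add h.unif h.coeff_ne_zero (f := fun w => ‖ℓ w‖)
          (fun z w hzw => by rw [hℓper z w hzw]) _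
      simp only [this]
      exact integrable_const _
  have hswap := integral_integral_swap (f := fun z w => ℓ (2 * z - w)) hint
  have hleft : ∫ z in F, ∫ w in F, ℓ (2 * z - w) = 0 := by
    simp only [heven, htr, integral_zero]
  have hright : ∀ w : ℂ, ∫ z in F, ℓ (2 * z - w) = C := by
    intro w
    have hvi : IntegrableOn (fun z => v (z + -(w / 2))) F := by
      have hvF : IntegrableOn v F := by
        refine Integrable.congr (integrable_const C) ?_
        exact ae_restrict_of_ae ((ae_of_forall_nhdsNE hC).mono fun z hz => hz.symm)
      exact h.fundamental.integrableOn_add h.unif h.coeff_ne_zero hper hvF _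
    have hvint : ∫ z in F, v (z + -(w / 2)) = C := by
      rw [h.fundamental.setIntegral_add h.unif h.coeff_ne_zero hper,
        ← h.setIntegral_const C]
      exact integral_congr_ae (ae_restrict_of_ae (ae_of_forall_nhdsNE hC))
    have e : ∀ z, ℓ (2 * z - w) = v (z + -(w / 2)) + ∑ i, ℓ (z + (-(w / 2) - T i)) := by
      intro z
      simp only [hvdef]
      rw [show 2 * (z + -(w / 2)) = 2 * z - w by ring]
      have : ∀ i, z + -(w / 2) - T i = z + (-(w / 2) - T i) := fun i => by ring
      simp only [this]
      ring
    simp only [e]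
    rw [integral_add hvi (integrable_finsetSum _ fun i _ => htri _),
      integral_finsetSum _ fun i _ => htri _, hvint]
    simp only [htr, Finset.sum_const_zero, add_zero]
  have hC0 : C = 0 := by
    rw [hleft] at hswap
    simp only [hright, h.setIntegral_const] at hswap
    exact hswap.symm
  filter_upwards [hC z₀] with z hz
  rw [hC0] at hz
  exact sub_eq_zero.1 hz

/-- The product of the values of the Green function at the points of order two is `2`. -/
theorem sum_log_green_two_torsion [T2Space X] [CompactSpace X] [BorelSpace X]
    (h : GreenUniformization G η O π F) (t : Fin 3 → ℂ)
    (htinj : Function.Injective (π ∘ t)) (ht0 : ∀ i, π (t i) ≠ O)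
    (ht : ∀ z, π (2 * z) = O ↔ π z = O ∨ ∃ i, π z = π (t i)) :
    ∑ i, Real.log (G O (π (t i))) = Real.log 2 := by
  classical
  have hd := h.log_green_two_mul (Fin.cons 0 t) (by
      intro i j
      refine Fin.cases ?_ (fun i => ?_) i <;> refine Fin.cases ?_ (fun j => ?_) j
      · simp
      · intro hij
        simp only [Function.comp_apply, Fin.cons_zero, Fin.cons_succ, h.unif.map_zero] at hij
        exact absurd hij.symm (ht0 j)
      · intro hij
        simp only [Function.comp_apply, Fin.cons_zero, Fin.cons_succ, h.unif.map_zero] at hij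
        exact absurd hij (ht0 i)
      · intro hij
        simp only [Function.comp_apply, Fin.cons_succ] at hij
        rw [htinj hij]) (by
      intro z
      rw [ht z]
      refine Iff.trans ?_ Fin.exists_fin_succ.symm
      simp only [Fin.cons_zero, Fin.cons_succ, h.unif.map_zero]) 0
  simp only [Fin.sum_univ_succ (n := 3), Fin.cons_zero, Fin.cons_succ, sub_zero] at hd
  obtain ⟨u, hu, h1, -⟩ := h.logSing_origin 0
  rw [if_pos h.unif.map_zero] at h1
  simp only [one_mul, sub_zero] at h1
  have htw : Tendsto (fun z : ℂ => 2 * z) (𝓝[≠] 0) (𝓝[≠] 0) := by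
    refine tendsto_nhdsWithin_of_tendsto_nhds_of_eventually_within _ ?_ ?_
    · have : Continuous fun z : ℂ => 2 * z := by fun_prop
      simpa using (this.tendsto 0).mono_left nhdsWithin_le_nhds
    · filter_upwards [self_mem_nhdsWithin] with z hz
      simpa using hz
  have l1 : Tendsto (fun z => Real.log 2 + u (2 * z) - u z) (𝓝[≠] 0) (𝓝 (Real.log 2)) := by
    have a1 := hu.continuousAt.tendsto.comp (htw.mono_right nhdsWithin_le_nhds)
    have a2 := hu.continuousAt.tendsto.mono_left (nhdsWithin_le_nhds (s := {0}ᶜ))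
    simpa using (a1.const_add (Real.log 2)).sub a2
  have l2 : Tendsto (fun z => ∑ i, Real.log (G O (π (z - t i)))) (𝓝[≠] 0)
      (𝓝 (∑ i, Real.log (G O (π (t i))))) := by
    refine tendsto_finsetSum _ fun i _ => ?_
    have hc : ContinuousAt (fun z => Real.log (G O (π (z - t i)))) 0 := by
      refine ContinuousAt.comp (g := fun z => Real.log (G O (π z))) (f := fun z => z - t i)
        (h.continuousAt_log_origin ?_) (by fun_prop)
      rw [zero_sub, Ne, h.map_neg_iff]
      exact ht0 i
    have := hc.tendsto.mono_left (nhdsWithin_le_nhds (s := {0}ᶜ))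
    simpa [h.log_green_neg] using this
  refine tendsto_nhds_unique (l2.congr' ?_) l1
  filter_upwards [hd, h1, htw.eventually h1, self_mem_nhdsWithin] with z hz1 hz2 hz3 hz4
  have hz : ‖z‖ ≠ 0 := norm_ne_zero_iff.2 hz4
  rw [norm_mul, Real.log_mul (by simp) hz, Complex.norm_ofNat] at hz3
  linarith

end GreenUniformization

end Green

end RiemannSurface

namespace RiemannSurface

open Filter Set Metric
open scoped Topology

/-! ### The involution of a Weierstrass curve -/

section Weierstrass

variable {X : Type*} [TopologicalSpace X] [ChartedSpace ℂ X] {α : Fin 3 → ℂ} {O : X} {x y : X → ℂ}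

omit [ChartedSpace ℂ X] in
theorem map_chart_nhdsNE {e : OpenPartialHomeomorph X ℂ} {Q : X} (hQ : Q ∈ e.source)
    {β : Type*} {f : X → β} {l : Filter β} (hf : Tendsto (f ∘ e.symm) (𝓝[≠] (e Q)) l) :
    Tendsto f (𝓝[≠] Q) l := by
  refine (hf.comp (tendsto_chart_nhdsNE hQ)).congr' ?_
  filter_upwards [mem_nhdsWithin_of_mem_nhds (e.open_source.mem_nhds hQ)] with w hw
  simp [e.left_inv hw]

theorem IsWeierstrassEquation.isClosedEmbedding [T2Space X] [CompactSpace X]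
    [IsManifold 𝓘(ℂ) ω X] (hW : IsWeierstrassEquation α O x y) [DecidableEq X] :
    Topology.IsClosedEmbedding (fun Q => if Q = O then (OnePoint.infty : OnePoint (ℂ × ℂ))
      else ((x Q, y Q) : ℂ × ℂ)) := by
  refine Continuous.isClosedEmbedding (continuous_iff_continuousAt.2 fun Q => ?_) ?_
  · by_cases hQ : Q = O
    · subst hQ
      rw [ContinuousAt, if_pos rfl, ← nhdsNE_sup_pure Q]
      refine Tendsto.sup ?_ ?_
      · have hx : Tendsto x (𝓝[≠] Q) (Bornology.cobounded ℂ) := by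
          refine map_chart_nhdsNE (mem_chart_source ℂ Q) (tendsto_cobounded_of_meromorphicOrderAt_neg ?_)
          rw [hW.pole_x]
          exact WithTop.coe_lt_coe.2 (by norm_num)
        have hxy : Tendsto (fun Q => (x Q, y Q)) (𝓝[≠] Q) (Bornology.cobounded (ℂ × ℂ)) := by
          rw [← tendsto_norm_atTop_iff_cobounded] at hx ⊢
          exact tendsto_atTop_mono (fun Q => le_max_left _ _) hx
        rw [Metric.cobounded_eq_cocompact, ← coclosedCompact_eq_cocompact] at hxy
        refine (OnePoint.tendsto_coe_infty.comp hxy).congr' ?_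
        filter_upwards [self_mem_nhdsWithin] with w hw
        exact (if_neg hw).symm
      · rw [tendsto_pure_left]
        intro s hs
        rw [if_pos rfl]
        exact mem_of_mem_nhds hs
    · have h1 : ContinuousAt (fun Q => (((x Q, y Q) : ℂ × ℂ) : OnePoint (ℂ × ℂ))) Q :=
        OnePoint.continuous_coe.continuousAt.comp
          ((hW.mdiff_x hQ).continuousAt.prodMk (hW.mdiff_y hQ).continuousAt)
      refine h1.congr ?_
      filter_upwards [isOpen_ne.mem_nhds hQ] with w hw
      rw [if_neg hw]
  · intro Q Q' h
    simp only at h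
    split_ifs at h with h1 h2 h2
    · rw [h1, h2]
    · exact absurd h (OnePoint.infty_ne_coe _)
    · exact absurd h (OnePoint.coe_ne_infty _)
    · exact hW.bijOn.injOn h1 h2 (OnePoint.coe_injective h)

theorem IsWeierstrassEquation.exists_involution [T2Space X] [CompactSpace X]
    [IsManifold 𝓘(ℂ) ω X] (hW : IsWeierstrassEquation α O x y) :
    ∃ σ : X → X, Continuous σ ∧ σ O = O ∧
      ∀ Q, Q ≠ O → σ Q ≠ O ∧ x (σ Q) = x Q ∧ y (σ Q) = - y Q := by
  classical
  have hex : ∀ Q : X, ∃ Q' : X, (Q = O → Q' = O) ∧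
      (Q ≠ O → Q' ≠ O ∧ x Q' = x Q ∧ y Q' = - y Q) := by
    intro Q
    by_cases hQ : Q = O
    · exact ⟨O, fun _ => rfl, fun h => absurd hQ h⟩
    · have hmem : ((x Q, -y Q) : ℂ × ℂ) ∈
          {w : ℂ × ℂ | w.2 ^ 2 = 4 * (w.1 - α 0) * (w.1 - α 1) * (w.1 - α 2)} := by
        simp only [mem_ofPred_eq, neg_sq]
        exact hW.eq hQ
      obtain ⟨Q', hQ', h⟩ := hW.bijOn.surjOn hmem
      rw [Prod.mk.injEq] at h
      exact ⟨Q', fun h => absurd h hQ, fun _ => ⟨hQ', h.1, h.2⟩⟩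
  choose σ hσ1 hσ2 using hex
  refine ⟨σ, ?_, hσ1 O rfl, hσ2⟩
  rw [hW.isClosedEmbedding.isInducing.continuous_iff]
  have hneg : Continuous (OnePoint.map fun p : ℂ × ℂ => (p.1, -p.2)) := by
    refine OnePoint.continuous_map (by fun_prop) ?_
    rw [coclosedCompact_eq_cocompact]
    exact ((Homeomorph.refl ℂ).prodCongr (Homeomorph.neg ℂ)).isClosedEmbedding.tendsto_cocompact
  refine (hneg.comp hW.isClosedEmbedding.continuous).congr fun Q => ?_
  simp only [Function.comp_apply]
  by_cases hQ : Q = O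
  · rw [if_pos hQ, if_pos (hσ1 Q hQ), OnePoint.map_infty]
  · obtain ⟨h1, h2, h3⟩ := hσ2 Q hQ
    rw [if_neg hQ, if_neg h1, h2, h3, OnePoint.map_some]

variable {η : CovectorField X} {π : ℂ → X}

theorem IsUniformization.hasDerivAt_comp [IsManifold 𝓘(ℂ) ω X] (h : IsUniformization η O π)
    {f : X → ℂ} {z : ℂ} (hf : MDifferentiableAt 𝓘(ℂ) 𝓘(ℂ) f (π z)) :
    HasDerivAt (f ∘ π) (deriv (f ∘ (chartAt ℂ (π z)).symm) (chartAt ℂ (π z) (π z)) *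
      (coeff η (chartAt ℂ (π z)) (chartAt ℂ (π z) (π z)))⁻¹) z := by
  have hea := chart_mem_atlas ℂ (π z)
  have hs := mem_chart_source ℂ (π z)
  set e := chartAt ℂ (π z)
  have h1 : DifferentiableAt ℂ (f ∘ e.symm) ((e ∘ π) z) := by
    refine (mdifferentiableAt_iff_chart hea (e.map_source hs)).1 ?_
    rwa [e.left_inv hs]
  refine (h1.hasDerivAt.comp z (h.hasDerivAt e hea z hs)).congr_of_eventuallyEq ?_
  filter_upwards [h.continuous.continuousAt.eventually (e.open_source.mem_nhds hs)] with w hw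
  simp [e.left_inv hw]

theorem IsUniformization.hasDerivAt_x [IsManifold 𝓘(ℂ) ω X] [T2Space X]
    (h : IsUniformization η O π)
    (h0 : ∀ e ∈ atlas ℂ X, ∀ z ∈ e.target, coeff η e z ≠ 0)
    (hW : IsWeierstrassEquation α O x y) {c : ℂ} (hc0 : c ≠ 0)
    (hc : ∀ e ∈ atlas ℂ X, ∀ z ∈ e.target, e.symm z ≠ O →
        c * deriv (x ∘ e.symm) z = y (e.symm z) * coeff η e z) {z : ℂ} (hz : π z ≠ O) :
    HasDerivAt (x ∘ π) (c⁻¹ * y (π z)) z := by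
  refine (h.hasDerivAt_comp (hW.mdiff_x hz)).congr_deriv ?_
  have hea := chart_mem_atlas ℂ (π z)
  have hs := mem_chart_source ℂ (π z)
  set e := chartAt ℂ (π z)
  have h1 := hc e hea (e (π z)) (e.map_source hs) (by rwa [e.left_inv hs])
  rw [e.left_inv hs] at h1
  have h2 := h0 e hea _ (e.map_source hs)
  field_simp
  linear_combination h1

theorem IsWeierstrassEquation.y_ne_zero [T2Space X] (hW : IsWeierstrassEquation α O x y)
    {P : Fin 3 → X} (hP : ∀ i, P i ≠ O ∧ x (P i) = α i ∧ y (P i) = 0) {Q : X} (hQ : Q ≠ O)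
    (h : ∀ i, Q ≠ P i) : y Q ≠ 0 := by
  intro hy
  have h1 := hW.eq hQ
  rw [hy, zero_pow two_ne_zero, eq_comm] at h1
  have key : ∀ i, x Q ≠ α i := fun i hi => h i
    (hW.bijOn.injOn hQ (hP i).1 (Prod.ext (hi.trans (hP i).2.1.symm) (hy.trans (hP i).2.2.symm)))
  simp only [mul_eq_zero, OfNat.ofNat_ne_zero, false_or, sub_eq_zero] at h1
  rcases h1 with (h1 | h1) | h1
  exacts [key 0 h1, key 1 h1, key 2 h1]

theorem eventually_map_ne_point (h : IsUniformization η O π)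
    (h0 : ∀ e ∈ atlas ℂ X, ∀ z ∈ e.target, coeff η e z ≠ 0) [T2Space X] (z : ℂ) (Q : X) :
    ∀ᶠ w in 𝓝[≠] z, π w ≠ Q := by
  by_cases hQ : π z = Q
  · subst hQ; exact eventually_map_ne h h0 z
  · exact (h.continuous.continuousAt.eventually (isOpen_ne.mem_nhds hQ)).filter_mono
      nhdsWithin_le_nhds

/-- If the holomorphic functions `ξ ∘ s` and `ψ` agree and `s` is continuous, then `s` is
differentiable where the derivative of `ξ` does not vanish. -/
theorem hasDerivAt_of_comp_eq {ξ ψ s : ℂ → ℂ} {a b z : ℂ} (hs : ContinuousAt s z)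
    (hξ : HasStrictDerivAt ξ a (s z)) (ha : a ≠ 0) (hψ : HasDerivAt ψ b z)
    (h : ∀ᶠ w in 𝓝 z, ξ (s w) = ψ w) : HasDerivAt s (a⁻¹ * b) z := by
  have h1 := hξ.to_localInverse ha
  have h2 : ξ (s z) = ψ z := h.self_of_nhds
  rw [h2] at h1
  have h3 := h1.hasDerivAt.comp z hψ
  refine h3.congr_of_eventuallyEq ?_
  have h4 := hs.eventually ((hξ.hasStrictFDerivAt_equiv ha).eventually_left_inverse)
  filter_upwards [h, h4] with w h5 h6
  rw [Function.comp_apply, ← h5]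
  exact h6.symm

/-- The involution `(x, y) ↦ (x, -y)` is multiplication by `-1`. -/
theorem IsUniformization.involution_eq [T2Space X] [CompactSpace X]
    [IsManifold 𝓘(ℂ) ω X] (h : IsUniformization η O π)
    (h0 : ∀ e ∈ atlas ℂ X, ∀ z ∈ e.target, coeff η e z ≠ 0)
    (hW : IsWeierstrassEquation α O x y) {c : ℂ} (hc0 : c ≠ 0)
    (hc : ∀ e ∈ atlas ℂ X, ∀ z ∈ e.target, e.symm z ≠ O →
        c * deriv (x ∘ e.symm) z = y (e.symm z) * coeff η e z)
    {P : Fin 3 → X} (hP : ∀ i, P i ≠ O ∧ x (P i) = α i ∧ y (P i) = 0)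
    {σ : X → X} (hσc : Continuous σ) (hσO : σ O = O)
    (hσ : ∀ Q, Q ≠ O → σ Q ≠ O ∧ x (σ Q) = x Q ∧ y (σ Q) = - y Q) (z : ℂ) :
    σ (π (-z)) = π z := by
  obtain ⟨r, hr, hinj⟩ := h.exists_injOn h0
  have hlift : ∀ w₀ : ℂ, ∃ p : OpenPartialHomeomorph ℂ X, p.source = ball w₀ r ∧ ⇑p = π := by
    intro w₀
    refine ⟨OpenPartialHomeomorph.ofContinuousOpen ((hinj w₀).toPartialEquiv π (ball w₀ r))
      h.continuous.continuousOn (h.isOpenMap h0) isOpen_ball, rfl, rfl⟩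
  set 𝒯 : Set (OpenPartialHomeomorph X ℂ) := {q | ∃ w₀, q.target = ball w₀ r ∧ ⇑q.symm = π}
  have cov : ∀ Q : X, ∃ q ∈ 𝒯, Q ∈ q.source := by
    intro Q
    obtain ⟨w₀, rfl⟩ := h.surjective Q
    obtain ⟨p, hp, hpπ⟩ := hlift w₀
    refine ⟨p.symm, ⟨w₀, hp, hpπ⟩, ?_⟩
    rw [← hpπ]
    exact p.map_source (by rw [hp]; exact mem_ball_self hr)
  have hπfl : IsFlowLine 𝒯 π univ := by
    rintro z - q ⟨w₀, hq, hqπ⟩ hz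
    have hv := q.left_inv hz
    rw [hqπ] at hv
    refine Eventually.of_forall fun t => ?_
    rw [hqπ]
    exact h.congr_add _ _ t hv.symm
  set B : ℂ → X := fun z => σ (π (-z)) with hB
  have hBc : Continuous B := hσc.comp (h.continuous.comp continuous_neg)
  have hbad : ∀ z₀, ∀ᶠ z in 𝓝[≠] z₀, π (-z) ≠ O ∧ y (π (-z)) ≠ 0 := by
    intro z₀
    have ht : Tendsto (fun z : ℂ => -z) (𝓝[≠] z₀) (𝓝[≠] (-z₀)) := by
      refine tendsto_nhdsWithin_of_tendsto_nhds_of_eventually_within _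
        ((continuous_neg.tendsto z₀).mono_left nhdsWithin_le_nhds) ?_
      filter_upwards [self_mem_nhdsWithin] with z hz
      simpa using hz
    have hall : ∀ᶠ z in 𝓝[≠] z₀, ∀ i, π (-z) ≠ P i := eventually_all.2 fun i =>
      ht.eventually (eventually_map_ne_point h h0 _ (P i))
    filter_upwards [ht.eventually (eventually_map_ne_point h h0 _ O), hall] with z h1 h2
    exact ⟨h1, hW.y_ne_zero hP h1 h2⟩
  have hBfl : IsFlowLine 𝒯 B univ := by
    rintro z₀ - q ⟨w₀, hq, hqπ⟩ hz₀
    set s : ℂ → ℂ := fun z => q (B z) with hs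
    have hsrc : ∀ᶠ z in 𝓝 z₀, B z ∈ q.source :=
      hBc.continuousAt.eventually (q.open_source.mem_nhds hz₀)
    have hπs : ∀ z, B z ∈ q.source → π (s z) = B z := fun z hz => by
      have := q.left_inv hz
      rwa [hqπ] at this
    have hsc : ∀ z, B z ∈ q.source → ContinuousAt s z := fun z hz =>
      (q.continuousAt hz).comp hBc.continuousAt
    have hsd : ∀ᶠ z in 𝓝[≠] z₀, HasDerivAt s 1 z := by
      filter_upwards [hsrc.eventually_nhds.filter_mono nhdsWithin_le_nhds, hbad z₀]
        with z hz ⟨hzO, hzy⟩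
      have hzs := hz.self_of_nhds
      obtain ⟨hσ1, hσ2, hσ3⟩ := hσ _ hzO
      have hsz : π (s z) ≠ O := by rw [hπs z hzs]; exact hσ1
      have hξa : AnalyticAt ℂ (x ∘ π) (s z) := by
        rw [Complex.analyticAt_iff_eventually_differentiableAt]
        filter_upwards [h.continuous.continuousAt.eventually (isOpen_ne.mem_nhds hsz)] with w hw
        exact (h.hasDerivAt_x h0 hW hc0 hc hw).differentiableAt
      have hξ := (hξa.contDiffAt (n := 1)).hasStrictDerivAt'
        (h.hasDerivAt_x h0 hW hc0 hc hsz) (by simp)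
      have hψ : HasDerivAt (fun w => (x ∘ π) (-w)) (c⁻¹ * y (π (-z)) * -1) z :=
        (h.hasDerivAt_x h0 hW hc0 hc hzO).comp z (hasDerivAt_neg' z)
      have hys : y (π (s z)) = - y (π (-z)) := by rw [hπs z hzs]; exact hσ3
      have hne : c⁻¹ * y (π (s z)) ≠ 0 := by
        rw [hys]
        exact mul_ne_zero (inv_ne_zero hc0) (neg_ne_zero.2 hzy)
      refine (hasDerivAt_of_comp_eq (hsc z hzs) hξ hne hψ ?_).congr_deriv ?_
      · have hO : ∀ᶠ w in 𝓝 z, π (-w) ≠ O :=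
          (h.continuous.comp continuous_neg).continuousAt.eventually (isOpen_ne.mem_nhds hzO)
        filter_upwards [hz, hO] with w hw hwO
        rw [Function.comp_apply, hπs w hw]
        exact (hσ _ hwO).2.1
      · rw [hys]
        field_simp
    have hsa : AnalyticAt ℂ s z₀ :=
      Complex.analyticAt_of_differentiable_on_punctured_nhds_of_continuousAt
        (hsd.mono fun z hz => hz.differentiableAt) (hsc z₀ hz₀)
    have hd1 : deriv s z₀ = 1 :=
      tendsto_nhds_unique (hsa.deriv.continuousAt.tendsto.mono_left
        (nhdsWithin_le_nhds (s := {z₀}ᶜ)))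
        (tendsto_const_nhds.congr' (hsd.mono fun z hz => hz.deriv.symm))
    have hsd' : ∀ᶠ z in 𝓝 z₀, HasDerivAt s 1 z := by
      rw [eventually_nhdsWithin_iff] at hsd
      filter_upwards [hsd] with z hz
      by_cases hzz : z = z₀
      · rw [hzz, ← hd1]; exact hsa.differentiableAt.hasDerivAt
      · exact hz hzz
    have hfin := (eventually_add_iff z₀).2 ((eventually_eq_add_of_hasDerivAt_one hsd').and hsrc)
    filter_upwards [hfin] with t ht
    obtain ⟨h1, h2⟩ := ht
    rw [add_sub_cancel_left] at h1
    rw [← hπs _ h2, h1, hqπ]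
  exact hBfl.eqOn cov isPreconnected_univ hπfl (mem_univ 0) (by simp [hB, h.map_zero, hσO])
    (mem_univ z)

theorem IsUniformization.two_mul_eq_iff [T2Space X] [CompactSpace X]
    [IsManifold 𝓘(ℂ) ω X] (h : IsUniformization η O π)
    (h0 : ∀ e ∈ atlas ℂ X, ∀ z ∈ e.target, coeff η e z ≠ 0)
    (hW : IsWeierstrassEquation α O x y) {c : ℂ} (hc0 : c ≠ 0)
    (hc : ∀ e ∈ atlas ℂ X, ∀ z ∈ e.target, e.symm z ≠ O →
        c * deriv (x ∘ e.symm) z = y (e.symm z) * coeff η e z)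
    {P : Fin 3 → X} (hP : ∀ i, P i ≠ O ∧ x (P i) = α i ∧ y (P i) = 0) (z : ℂ) :
    π (2 * z) = O ↔ π z = O ∨ ∃ i, π z = P i := by
  obtain ⟨σ, hσc, hσO, hσ⟩ := hW.exists_involution
  have hinv := h.involution_eq h0 hW hc0 hc hP hσc hσO hσ
  have h1 : π (2 * z) = O ↔ π z = σ (π z) := by
    have h2 := hinv (-z)
    rw [neg_neg] at h2
    rw [h2, h.map_eq_iff, sub_neg_eq_add, two_mul]
  rw [h1]
  constructor
  · intro h2
    by_contra! h3
    have h4 := (hσ _ h3.1).2.2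
    rw [← h2] at h4
    exact hW.y_ne_zero hP h3.1 h3.2 (self_eq_neg.1 h4)
  · rintro (h2 | ⟨i, h2⟩)
    · rw [h2, hσO]
    · rw [h2]
      obtain ⟨h3, h4, h5⟩ := hσ _ (hP i).1
      refine hW.bijOn.injOn (hP i).1 h3 (Prod.ext h4.symm ?_)
      rw [h5, (hP i).2.2, neg_zero]

end Weierstrass

end RiemannSurface

namespace RiemannSurface

open Filter Set Metric
open scoped Topology

/-! ### Values of the Green function at the points of order two -/

theorem meromorphicOrderAt_eq_two {f g : ℂ → ℂ} {z₀ : ℂ} (hf : AnalyticAt ℂ f z₀)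
    (hg : AnalyticAt ℂ g z₀) (hf0 : f z₀ = 0) (hg0 : g z₀ ≠ 0)
    (hne : ∀ᶠ z in 𝓝[≠] z₀, f z ≠ 0) (h : ∀ᶠ z in 𝓝[≠] z₀, deriv f z ^ 2 = f z * g z) :
    meromorphicOrderAt f z₀ = (2 : ℤ) := by
  have htop : meromorphicOrderAt f z₀ ≠ ⊤ := by
    rw [Ne, meromorphicOrderAt_eq_top_iff]
    intro h0
    obtain ⟨z, h1, h2⟩ := (h0.and hne).exists
    exact h2 h1
  obtain ⟨n, hn⟩ := WithTop.ne_top_iff_exists.1 htop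
  have hn0 : n ≠ 0 := by
    rintro rfl
    refine (hf.analyticOrderAt_eq_zero.not.2 (not_not.2 hf0)) ?_
    rw [hf.meromorphicOrderAt_eq] at hn
    cases hk : analyticOrderAt f z₀ with
    | top => rw [hk] at hn; exact absurd hn (by simp)
    | coe k =>
      rw [hk, ENat.map_natCast] at hn
      have := WithTop.coe_injective hn
      exact_mod_cast this.symm
  have hd := meromorphicOrderAt_deriv_eq_sub_one (Int.cast_ne_zero.2 hn0) hn.symm
  have hgo : meromorphicOrderAt g z₀ = 0 := by
    rw [hg.meromorphicOrderAt_eq, hg.analyticOrderAt_eq_zero.2 hg0]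
    rfl
  have h1 : meromorphicOrderAt (deriv f ^ 2) z₀ = meromorphicOrderAt (f * g) z₀ :=
    meromorphicOrderAt_congr h
  rw [meromorphicOrderAt_pow hf.deriv.meromorphicAt,
    meromorphicOrderAt_mul hf.meromorphicAt hg.meromorphicAt, hd, hgo, add_zero, ← hn] at h1
  have h2 : 2 * (n - 1) = n := WithTop.coe_injective h1
  rw [← hn]
  norm_cast
  omega

section

variable {X : Type*} [TopologicalSpace X] [ChartedSpace ℂ X] [T2Space X] [IsManifold 𝓘(ℂ) ω X]
  {α : Fin 3 → ℂ} {O : X} {x y : X → ℂ} {η : CovectorField X} {π : ℂ → X}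

theorem IsUniformization.analyticAt_x (h : IsUniformization η O π)
    (hW : IsWeierstrassEquation α O x y) {z : ℂ} (hz : π z ≠ O) : AnalyticAt ℂ (x ∘ π) z := by
  rw [Complex.analyticAt_iff_eventually_differentiableAt]
  filter_upwards [h.continuous.continuousAt.eventually (isOpen_ne.mem_nhds hz)] with w hw
  exact (h.hasDerivAt_comp (hW.mdiff_x hw)).differentiableAt

omit [T2Space X] [IsManifold 𝓘(ℂ) ω X] in
theorem IsUniformization.meromorphicOrderAt_x (h : IsUniformization η O π)
    (h0 : ∀ e ∈ atlas ℂ X, ∀ z ∈ e.target, coeff η e z ≠ 0)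
    (hW : IsWeierstrassEquation α O x y) {z : ℂ} (hz : π z = O) :
    meromorphicOrderAt (x ∘ π) z = ((-2 : ℤ) : WithTop ℤ) := by
  subst hz
  have hea := chart_mem_atlas ℂ (π z)
  have hs := mem_chart_source ℂ (π z)
  rw [← hW.pole_x]
  set e := chartAt ℂ (π z)
  have hsrc : ∀ᶠ w in 𝓝 z, π w ∈ e.source :=
    h.continuous.continuousAt.eventually (e.open_source.mem_nhds hs)
  have hd : deriv (e ∘ π) z ≠ 0 := by
    rw [(h.hasDerivAt e hea z hs).deriv]
    exact inv_ne_zero (h0 e hea _ (e.map_source hs))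
  have h1 := meromorphicOrderAt_comp_of_deriv_ne_zero (f := x ∘ e.symm) (h.analyticAt hea hs) hd
  rw [Function.comp_apply] at h1
  rw [← h1]
  refine meromorphicOrderAt_congr ?_
  filter_upwards [hsrc.filter_mono nhdsWithin_le_nhds] with w hw
  simp [e.left_inv hw]

open scoped Classical in
theorem IsUniformization.meromorphicOrderAt_x_sub (h : IsUniformization η O π)
    (h0 : ∀ e ∈ atlas ℂ X, ∀ z ∈ e.target, coeff η e z ≠ 0)
    (hW : IsWeierstrassEquation α O x y) {c : ℂ} (hc0 : c ≠ 0)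
    (hc : ∀ e ∈ atlas ℂ X, ∀ z ∈ e.target, e.symm z ≠ O →
        c * deriv (x ∘ e.symm) z = y (e.symm z) * coeff η e z)
    {P : Fin 3 → X} (hP : ∀ i, P i ≠ O ∧ x (P i) = α i ∧ y (P i) = 0) (i : Fin 3) (z₀ : ℂ) :
    MeromorphicAt (fun z => x (π z) - α i) z₀ ∧
      meromorphicOrderAt (fun z => x (π z) - α i) z₀
        = (((if π z₀ = P i then 2 else 0) - (if π z₀ = O then 2 else 0) : ℤ) : WithTop ℤ) := by
  by_cases hz : π z₀ = O
  · rw [if_pos hz, if_neg (by rw [hz]; exact (hP i).1.symm)]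
    have h1 := h.meromorphicOrderAt_x h0 hW hz
    have h2 : meromorphicOrderAt (fun z => x (π z) - α i) z₀ = ((-2 : ℤ) : WithTop ℤ) := by
      rw [← h1]
      have h3 : (fun z => x (π z) - α i) = (x ∘ π) + fun _ => -α i := by
        funext z
        simp [sub_eq_add_neg]
      rw [h3]
      refine meromorphicOrderAt_add_eq_left_of_lt (by fun_prop) ?_
      rw [h1, meromorphicOrderAt_const]
      split_ifs
      · exact WithTop.coe_lt_top _
      · exact WithTop.coe_lt_coe.2 (by norm_num)
    refine ⟨meromorphicAt_of_meromorphicOrderAt_ne_zero ?_, ?_⟩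
    · rw [h2]; decide
    · rw [h2]; norm_num
  have han : AnalyticAt ℂ (fun z => x (π z) - α i) z₀ :=
    (h.analyticAt_x hW hz).sub analyticAt_const
  refine ⟨han.meromorphicAt, ?_⟩
  rw [if_neg hz, sub_zero]
  by_cases hzi : π z₀ = P i
  · rw [if_pos hzi]
    have hx0 : x (π z₀) = α i := by rw [hzi]; exact (hP i).2.1
    set g : ℂ → ℂ := fun z => (c⁻¹) ^ 2 * 4 * ∏ l ∈ Finset.univ.erase i, ((x ∘ π) z - α l)
    have hg : AnalyticAt ℂ g z₀ := by
      exact analyticAt_const.mul (Finset.analyticAt_fun_prod _ fun l _ =>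
        (h.analyticAt_x hW hz).sub analyticAt_const)
    have hg0 : g z₀ ≠ 0 := by
      refine mul_ne_zero (mul_ne_zero (pow_ne_zero _ (inv_ne_zero hc0)) (by norm_num))
        (Finset.prod_ne_zero_iff.2 fun l hl => ?_)
      rw [Function.comp_apply, hx0, sub_ne_zero]
      exact hW.distinct.ne (Finset.ne_of_mem_erase hl).symm
    have hO := eventually_map_ne_point h h0 z₀ O
    have hprod : ∀ w, π w ≠ O → (c⁻¹ * y (π w)) ^ 2 = (x (π w) - α i) * g w := by
      intro w hw
      have h1 : y (π w) ^ 2 = 4 * ∏ l, (x (π w) - α l) := by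
        rw [hW.eq hw, Fin.prod_univ_three]
        ring
      rw [← Finset.mul_prod_erase _ _ (Finset.mem_univ i)] at h1
      simp only [g, Function.comp_apply]
      linear_combination c⁻¹ ^ 2 * h1
    have hall : ∀ᶠ z in 𝓝[≠] z₀, ∀ i, π z ≠ P i := eventually_all.2 fun i =>
      eventually_map_ne_point h h0 _ (P i)
    refine meromorphicOrderAt_eq_two han hg (sub_eq_zero.2 hx0) hg0 ?_ ?_
    · filter_upwards [hO, hall] with w hw hw' hw0
      have h1 := hprod w hw
      rw [hw0, zero_mul] at h1
      exact mul_ne_zero (inv_ne_zero hc0) (hW.y_ne_zero hP hw hw') (pow_eq_zero_iff two_ne_zero |>.1 h1)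
    · filter_upwards [hO] with w hw
      have h1 : HasDerivAt (fun z => x (π z) - α i) (c⁻¹ * y (π w)) w :=
        (h.hasDerivAt_x h0 hW hc0 hc hw).sub_const (α i)
      rw [h1.deriv, hprod w hw]
  · rw [if_neg hzi]
    have hx0 : x (π z₀) - α i ≠ 0 := by
      rw [sub_ne_zero]
      intro hx
      refine hzi (hW.bijOn.injOn hz (hP i).1 (Prod.ext (hx.trans (hP i).2.1.symm) ?_))
      have h1 := hW.eq hz
      have h2 : y (π z₀) ^ 2 = 4 * ∏ l, (x (π z₀) - α l) := by
        rw [h1, Fin.prod_univ_three]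
        ring
      rw [Finset.prod_eq_zero (Finset.mem_univ i) (sub_eq_zero.2 hx), mul_zero] at h2
      simpa [(hP i).2.2] using h2
    rw [han.meromorphicOrderAt_eq, han.analyticOrderAt_eq_zero.2 hx0]
    rfl

namespace GreenUniformization

variable [CompactSpace X] [MeasurableSpace X] {G : X → X → ℝ} {F : Set ℂ}

/-- The absolute value of `x - αᵢ` in terms of the Green function. -/
theorem exists_log_norm_eq (h : GreenUniformization G η O π F)
    (hW : IsWeierstrassEquation α O x y) {c : ℂ} (hc0 : c ≠ 0)
    (hc : ∀ e ∈ atlas ℂ X, ∀ z ∈ e.target, e.symm z ≠ O →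
        c * deriv (x ∘ e.symm) z = y (e.symm z) * coeff η e z)
    {P : Fin 3 → X} (hP : ∀ i, P i ≠ O ∧ x (P i) = α i ∧ y (P i) = 0) {i : Fin 3} {a : ℂ}
    (ha : π a = P i) :
    ∃ C, ∀ z, π z ≠ O → x (π z) ≠ α i → Real.log ‖x (π z) - α i‖ =
      2 * Real.log (G O (π (z - a))) - 2 * Real.log (G O (π z)) + C := by
  classical
  have hiff : ∀ z, π (z - a) = O ↔ π z = P i := fun z => by
    rw [← ha, h.unif.map_eq_iff]
  set v : ℂ → ℝ := fun z => Real.log ‖x (π z) - α i‖ - 2 * Real.log (G O (π (z - a))) +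
    2 * Real.log (G O (π z)) with hvdef
  have hv : ∀ z, LogSing v z 0 0 := by
    intro z₀
    obtain ⟨hm, ho⟩ := h.unif.meromorphicOrderAt_x_sub h.coeff_ne_zero hW hc0 hc hP i z₀
    have l1 := LogSing.log_norm hm ho
    have l2 := ((h.logSing_origin (1 * z₀ + -a)).comp_affine one_ne_zero).const_mul 2
    have l3 := (h.logSing_origin z₀).const_mul 2
    have l4 := (l1.sub l2).add l3
    simp only [one_mul, ← sub_eq_add_neg, hiff] at l4
    convert l4 using 1
    · push_cast
      split_ifs <;> norm_num
    · rw [norm_one]; ring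
  have hper : ∀ z w, π z = π w → v z = v w := fun z w hzw => by
    have : π (z - a) = π (w - a) := by
      simpa [sub_eq_add_neg] using h.unif.congr_add z w (-a) hzw
    simp only [hvdef, hzw, this]
  obtain ⟨C, hC⟩ := h.exists_eventually_eq_const hv hper
  refine ⟨C, fun z hz hx => ?_⟩
  have hza : π (z - a) ≠ O := fun h' => hx (by rw [(hiff z).1 h', (hP i).2.1])
  have hcont : ContinuousAt v z := by
    refine ContinuousAt.add (ContinuousAt.sub ?_ (ContinuousAt.const_mul ?_ _))
      ((h.continuousAt_log_origin hz).const_mul _)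
    · exact (((h.unif.analyticAt_x hW hz).continuousAt.sub continuousAt_const).norm).log
        (norm_ne_zero_iff.2 (sub_ne_zero.2 hx))
    · exact ContinuousAt.comp (g := fun z => Real.log (G O (π z))) (f := fun z => z - a)
        (h.continuousAt_log_origin hza) (by fun_prop)
  have := eq_of_eventually_nhdsNE (hC z) hcont
  simp only [hvdef] at this
  linarith

theorem log_green_two_torsion [BorelSpace X] (h : GreenUniformization G η O π F)
    (hW : IsWeierstrassEquation α O x y) {c : ℂ} (hc0 : c ≠ 0)
    (hc : ∀ e ∈ atlas ℂ X, ∀ z ∈ e.target, e.symm z ≠ O →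
        c * deriv (x ∘ e.symm) z = y (e.symm z) * coeff η e z)
    {P : Fin 3 → X} (hP : ∀ i, P i ≠ O ∧ x (P i) = α i ∧ y (P i) = 0)
    {i j k : Fin 3} (hij : i ≠ j) (hik : i ≠ k) (hjk : j ≠ k) :
    12 * Real.log (G (P i) (P j)) = 4 * Real.log 2 + 2 * Real.log ‖α i - α j‖
      - Real.log ‖α i - α k‖ - Real.log ‖α j - α k‖ := by
  have hPinj : Function.Injective P := fun a b hab => hW.distinct (by
    rw [← (hP a).2.1, ← (hP b).2.1, hab])
  choose t ht using fun i => h.unif.surjective (P i)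
  have hdouble := h.unif.two_mul_eq_iff h.coeff_ne_zero hW hc0 hc hP
  have ht2 : ∀ i, 2 * t i ∈ h.unif.periods := fun i => by
    rw [h.unif.mem_periods, hdouble]
    exact Or.inr ⟨i, ht i⟩
  have htO : ∀ i, t i ∉ h.unif.periods := fun i => by
    rw [h.unif.mem_periods, ht i]
    exact (hP i).1
  have hsub : ∀ {i j k : Fin 3}, i ≠ j → i ≠ k → j ≠ k → π (t j - t i) = P k := by
    intro i j k hij hik hjk
    have h1 : π (2 * (t j - t i)) = O := by
      rw [← h.unif.mem_periods, mul_sub]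
      exact sub_mem (ht2 j) (ht2 i)
    rcases (hdouble _).1 h1 with h2 | ⟨l, hl⟩
    · rw [← h.unif.map_eq_iff, ht, ht] at h2
      exact absurd (hPinj h2).symm hij
    · have hli : l ≠ i := by
        rintro rfl
        rw [← ht l, h.unif.map_eq_iff, ← h.unif.mem_periods] at hl
        have := add_mem hl (ht2 l)
        rw [show t j - t l - t l + 2 * t l = t j by ring] at this
        exact htO j this
      have hlj : l ≠ j := by
        rintro rfl
        rw [← ht l, h.unif.map_eq_iff, ← h.unif.mem_periods] at hl
        have := neg_mem hl
        rw [show -(t l - t i - t l) = t i by ring] at this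
        exact htO i this
      have hlk : l = k := by omega
      rw [hl, hlk]
  have hrel : ∀ {i j k : Fin 3}, i ≠ j → i ≠ k → j ≠ k →
      Real.log ‖α i - α j‖ - Real.log ‖α i - α k‖ =
        4 * Real.log (G O (P k)) - 4 * Real.log (G O (P j)) := by
    intro i j k hij hik hjk
    obtain ⟨C, hC⟩ := h.exists_log_norm_eq hW hc0 hc hP (ht i)
    have h1 := hC (t j) (by rw [ht]; exact (hP j).1)
      (by rw [ht, (hP j).2.1]; exact hW.distinct.ne hij.symm)
    have h2 := hC (t k) (by rw [ht]; exact (hP k).1)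
      (by rw [ht, (hP k).2.1]; exact hW.distinct.ne hik.symm)
    rw [hsub hij hik hjk, ht, (hP j).2.1, norm_sub_rev] at h1
    rw [hsub hik hij hjk.symm, ht, (hP k).2.1, norm_sub_rev] at h2
    linarith
  have hsum := h.sum_log_green_two_torsion t
    (fun a b hab => hPinj (by simpa only [Function.comp_apply, ht] using hab))
    (fun i => by rw [ht]; exact (hP i).1) (fun z => by simp only [ht]; exact hdouble z)
  simp only [ht] at hsum
  have huniv : (Finset.univ : Finset (Fin 3)) = {i, j, k} := by
    ext l
    simp only [Finset.mem_univ, Finset.mem_insert, Finset.mem_singleton, true_iff]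
    omega
  rw [huniv, Finset.sum_insert (by simp [hij, hik]), Finset.sum_pair hjk] at hsum
  have hG : Real.log (G (P i) (P j)) = Real.log (G O (P k)) := by
    rw [← ht i, ← ht j, h.log_green_eq, hsub hij hik hjk]
  have e1 := hrel hij hik hjk
  have e2 := hrel hij.symm hjk hik
  rw [norm_sub_rev (α j) (α i)] at e2
  rw [hG]
  linarith

end GreenUniformization

end

end RiemannSurface

theorem mainTheorem12
    {X : Type*} [TopologicalSpace X] [T2Space X] [CompactSpace X] [ConnectedSpace X]
    [ChartedSpace ℂ X] [IsManifold 𝓘(ℂ) ω X] [MeasurableSpace X] [BorelSpace X]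
    (hgenus : RiemannSurface.genus X = 1)
    (α : Fin 3 → ℂ) (O : X) (x y : X → ℂ) (hW : RiemannSurface.IsWeierstrassEquation α O x y)
    (P : Fin 3 → X) (hP : ∀ i, P i ≠ O ∧ x (P i) = α i ∧ y (P i) = 0)
    (G : X → X → ℝ) (hG : RiemannSurface.IsArakelovGreenFunction G)
    (i j k : Fin 3) (hij : i ≠ j) (hik : i ≠ k) (hjk : j ≠ k) :
    G (P i) (P j) ^ 12 = 16 * ‖α i - α j‖ ^ 2 / (‖α i - α k‖ * ‖α j - α k‖) := by
  obtain ⟨η, π, F, c, h, hc0, hc⟩ := RiemannSurface.exists_greenUniformization hG hW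
  have hlog := h.log_green_two_torsion hW hc0 hc hP hij hik hjk
  have hPij : P i ≠ P j := fun hPP => hW.distinct.ne hij (by
    rw [← (hP i).2.1, ← (hP j).2.1, hPP])
  have hpos := h.green_pos hPij
  have hα : ∀ {a b : Fin 3}, a ≠ b → 0 < ‖α a - α b‖ := fun hab =>
    norm_pos_iff.2 (sub_ne_zero.2 (hW.distinct.ne hab))
  have h1 := hα hij
  have h2 := hα hik
  have h3 := hα hjk
  refine Real.log_injOn_pos (Set.mem_Ioi.2 (pow_pos hpos 12)) (Set.mem_Ioi.2 (by positivity)) ?_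
  rw [Real.log_pow, Real.log_div (by positivity) (by positivity), Real.log_mul (by positivity)
    (by positivity), Real.log_mul h2.ne' h3.ne', Real.log_pow,
    show (16 : ℝ) = 2 ^ 4 by norm_num, Real.log_pow]
  push_cast
  linarith
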